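/- Notation, in $\mathbb R^2$. Let $B(x,r)$ be the ball of radius $r$ about $x$, let $m_2$ be Lebesgue measure, and let $\mathcal H^1$ be the one-dimensional Hausdorff measure $$\mathcal H^1(E)=\lim_{\varepsilon\to0^+}\inf\Bigl\{\sum_j 2r_j:\ E\subset\bigcup_j B(x_j,r_j),\ r_j\le\varepsilon\Bigr\}.$$ For a compact convex set $K\subset\mathbb R^2$ with support function $h_K(\theta)=\max_{x\in K}\langle x,\theta\rangle$, the mean width is $$\mathbf W(K)=\frac1\pi\int_{\mathbb S^1}h_K\,d\mathcal H^1 .$$ The lower surface density of $\Gamma\subset\mathbb R^2$ is $$\mathbf D^-(\Gamma)=\liminf_{r\to\infty}\inf_{x\in\mathbb R^2}\frac{\mathcal H^1(\Gamma\cap B(x,r))}{m_2(B(x,r))}.$$ Given $\varphi:[0,1)\to[0,\infty)$ continuous at $0$, a closed set $\Gamma\subset\mathbb R^2$ is called $\varphi$-regular if $\mathcal H^1(\Gamma\cap B(x,r))\le 2r\,\varphi(r)$ for all $x\in\mathbb R^2$ and $r\in(0,1)$. For $1\le p\le\infty$, $\mathcal{PW}_p(K)$ is the set of functions $f\in L^p(\mathbb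 R^2)$ (taken in their continuous representative) whose distributional Fourier transform $\widehat f$ (with $\widehat f(\xi)=\int f(x)e^{2\pi i\langle x,\xi\rangle}dx$ for integrable $f$) is supported in $K$. Theorem. Let $K\subset\mathbb R^2$ be a compact convex set with nonempty interior such that $(x_1,x_2)\in K\iff(-x_2,x_1)\in K$. Then: (a) For every $\delta>0$ there are a function $f\in\mathcal{PW}_\infty(K)$ (so $\operatorname{supp}\widehat f\subset K$) with $f(0)=\|f\|_\infty=1$, a function $\varphi:[0,1)\to[0,\infty)$ continuous at $0$ with $\varphi(0)=1$, and a $\varphi$-regular set $\Gamma\subset\{f=0\}$, such that $$\mathbf D^-(\Gamma)>\Bigl(\frac\pi2-\delta\Bigr)\mathbf W(K).$$ (b) Consequently $A_2=\pi/2$ cannot be lowered: let $A\in\mathbb R$ be such that for every $\varphi:[0,1)\to[0,\infty)$ continuous at $0$, every $\varphi$-regular $\Gamma$ with $\mathbf D^-(\Gamma)>\varphi(0)\,A\,\mathbf W(K)$ and every $1\le p\le\infty$ there is a constant $C$ with $\|f\|_{L^p(\mathbb R^2)}\le C\,\|f\|_{L^p(\Gamma,\mathcal H^1)}$ for all $f\in\mathcal{PW}_p(K)$.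 Then $A\ge\pi/2$. Moreover, for all $1\le p\le\infty$ and $R>0$, the closed $\ell^p$ ball $\{x\in\mathbb R^2:\|x\|_p\le R\}$ satisfies the hypotheses on $K$. -/

import Mathlib

open MeasureTheory Set Filter Topology FourierTransform
open scoped ENNReal NNReal SchwartzMap

noncomputable section

namespace MobileSampling

/-- The Euclidean plane. -/
abbrev Plane : Type := EuclideanSpace ℝ (Fin 2)

/-- A `π/2`-symmetric convex body in the plane: a compact convex set with nonempty interior that
is invariant under rotation by `π/2`. -/
structure IsQuarterTurnBody (K : Set Plane) : Prop where
  convex : Convex ℝ K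
  isCompact : IsCompact K
  interior_nonempty : (interior K).Nonempty
  quarter_turn : ∀ a b : ℝ, !₂[a, b] ∈ K ↔ !₂[-b, a] ∈ K

/-- The support function `h_K(θ) = max_{x ∈ K} ⟨x, θ⟩`. -/
def supportFun (K : Set Plane) (θ : Plane) : ℝ :=
  sSup ((fun x : Plane => inner ℝ x θ) '' K)

/-- The mean width `W(K) = (2 / (2π)) ∫_{S¹} h_K`, where the unit circle is parametrized by arc
length. -/
def meanWidth (K : Set Plane) : ℝ :=
  (2 / (2 * Real.pi)) *
    ∫ t in (0 : ℝ)..(2 * Real.pi), supportFun K !₂[Real.cos t, Real.sin t]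

/-- The cost of a covering set: `ω₁ r = 2 r` for a ball of radius `r`, and `∞` for a set that is
not a ball. -/
def ballCost (s : Set Plane) : ℝ≥0∞ :=
  ⨅ (x : Plane) (r : ℝ) (_ : s = Metric.ball x r), ENNReal.ofReal (2 * r)

/-- The one-dimensional Hausdorff measure
`H¹(E) = lim_{δ → 0} inf {∑ 2 r_j : E ⊆ ⋃ B(x_j, r_j), r_j ≤ δ}`, built by Carathéodory's
construction from countable coverings by small balls. -/
def hausdorffOne : Measure Plane := Measure.mkMetric' ballCost

/-- The lower surface density
`D⁻(Γ) = liminf_{r → ∞} inf_x H¹(Γ ∩ B(x, r)) / m₂(B(x, r))`. -/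
def lowerDensity (Γ : Set Plane) : ℝ≥0∞ :=
  liminf (fun r : ℝ =>
    ⨅ x : Plane, hausdorffOne (Γ ∩ Metric.ball x r) / volume (Metric.ball x r)) atTop

/-- A closed set `Γ` is `φ`-regular, where `φ : [0, 1) → [0, ∞)` is continuous at `0`, if
`H¹(Γ ∩ B(x, r)) ≤ φ(r) ω₁ r` for all `x` and all `r ∈ (0, 1)`; here `ω₁ = 2`. The values of `φ`
outside `[0, 1)` are irrelevant. -/
structure IsRegularSet (φ : ℝ → ℝ≥0) (Γ : Set Plane) : Prop where
  continuousAt_zero : ContinuousWithinAt φ (Ico 0 1) 0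
  isClosed : IsClosed Γ
  measure_le : ∀ (x : Plane) (r : ℝ), r ∈ Ioo (0 : ℝ) 1 →
    hausdorffOne (Γ ∩ Metric.ball x r) ≤ φ r * ENNReal.ofReal (2 * r)

/-- The Paley-Wiener space `PW_p(K)`: functions in `L^p` whose distributional Fourier transform is
supported in `K`. Each such function is represented by its continuous version. The Fourier
transform is normalized with the kernel `exp (2πi⟨x, ξ⟩)`, which is Mathlib's `𝓕⁻`. -/
def PaleyWiener (p : ℝ≥0∞) [Fact (1 ≤ p)] (K : Set Plane) : Set (Plane → ℂ) :=
  {f | Continuous f ∧ ∃ hf : MemLp f p (volume : Measure Plane),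
    Distribution.dsupport (𝓕⁻ (Lp.toTemperedDistribution (hf.toLp f)) : 𝓢'(Plane, ℂ)) ⊆ K}

/-- `A` is an admissible constant for mobile sampling with spectrum `K`: whenever `Γ` is
`φ`-regular with `D⁻(Γ) > φ(0) A W(K)`, then for every `1 ≤ p ≤ ∞` there is `C` such that
`‖f‖_{L^p(ℝ²)} ≤ C ‖f‖_{L^p(Γ, H¹)}` for every `f ∈ PW_p(K)`. -/
def IsSamplingConstant (K : Set Plane) (A : ℝ) : Prop :=
  ∀ (φ : ℝ → ℝ≥0) (Γ : Set Plane), IsRegularSet φ Γ →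
    (((φ 0 : ℝ) * A * meanWidth K : ℝ) : EReal) < (lowerDensity Γ : EReal) →
    ∀ (p : ℝ≥0∞) [Fact (1 ≤ p)], ∃ C : ℝ≥0, ∀ f ∈ PaleyWiener p K,
      eLpNorm f p volume ≤ C * eLpNorm f p (hausdorffOne.restrict Γ)

/-- The closed `ℓ^p` ball of radius `R` in the plane, centered at the origin. -/
def lpBall (p : ℝ≥0∞) (R : ℝ) : Set Plane :=
  {x | ‖(WithLp.toLp p x.ofLp : PiLp p (fun _ : Fin 2 => ℝ))‖ ≤ R}

end MobileSampling

end

open MeasureTheory Set Filter Topology FourierTransform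
open scoped ENNReal NNReal SchwartzMap

noncomputable section

namespace MobileSampling

/-! A product of cosines `∏ cos (2π⟨x, v i⟩)` has its spectrum in the signed sums `∑ ± v i`, hence
in the zonotope generated by the segments `[-v i, v i]`. Its zero set is a union of families of
parallel lines; the `i`-th family has spacing `1 / (2‖v i‖)`, so the total length per unit area is
`2 ∑ ‖v i‖`, half the perimeter of the zonotope. By Cauchy's formula half the perimeter of `K` is
`π/2 · W(K)`. It therefore suffices to inscribe in the centrally symmetric body `K` a zonotope of
almost the same perimeter: `exists_inscribed_zonotope` takes a symmetric polygon whose vertices are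
support points of `K` in equally spaced directions.

The full zero set is not regular with `φ(0) = 1`, because several lines meet at a crossing. Points
on one line where another cosine is smaller than `ε` in absolute value are removed. What remains
looks like a single line at small scales (`exists_radius_hausdorffOne_le`). Once parallel generators
have been merged (`exists_pairwise_cross_ne_zero`), all crossings are transversal and the removal
costs only a fraction `O(ε)` of the length (`exists_le_hausdorffOne_zeroSet`).

Such an `f` has sup norm `1` but vanishes on `Γ`, so no sampling inequality with `p = ∞` can hold.
This gives (b). -/

/-! ### Spherical Hausdorff measure of lines and segments. -/

theorem ballCost_ball_le (x : Plane) (r : ℝ) :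
    ballCost (Metric.ball x r) ≤ ENNReal.ofReal (2 * r) :=
  iInf_le_of_le x (iInf_le_of_le r (iInf_le _ rfl))

theorem ediam_ball_le (x : Plane) (r : ℝ) :
    Metric.ediam (Metric.ball x r) ≤ ENNReal.ofReal (2 * r) := by
  rw [← Metric.eball_ofReal, ENNReal.ofReal_mul zero_le_two, ENNReal.ofReal_ofNat]
  exact Metric.ediam_eball_le

theorem hausdorffOne_apply {s : Set Plane} (hs : MeasurableSet s) :
    hausdorffOne s = OuterMeasure.mkMetric' ballCost s :=
  toMeasure_apply _ (OuterMeasure.mkMetric'_isMetric _).le_caratheodory hs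

/-- The spherical Hausdorff measure dominates the usual one. -/
theorem hausdorffMeasure_le_hausdorffOne : Measure.hausdorffMeasure 1 ≤ hausdorffOne := by
  refine Measure.le_iff.2 fun s hs => ?_
  have hH : ∀ s : Set Plane, MeasurableSet s → Measure.hausdorffMeasure 1 s =
      OuterMeasure.mkMetric' (fun s : Set Plane => Metric.ediam s ^ (1 : ℝ)) s :=
    fun s hs => toMeasure_apply _ (OuterMeasure.mkMetric'_isMetric _).le_caratheodory hs
  rw [hausdorffOne_apply hs, hH s hs]
  have : OuterMeasure.mkMetric' (fun s : Set Plane => Metric.ediam s ^ (1 : ℝ)) ≤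
      OuterMeasure.mkMetric' ballCost := by
    refine iSup₂_mono fun r _ => OuterMeasure.mkMetric'.le_pre.2 fun t ht => ?_
    refine (OuterMeasure.mkMetric'.pre_le ht).trans ?_
    refine le_iInf fun x => le_iInf fun ρ => le_iInf fun h => ?_
    rw [h, ENNReal.rpow_one]
    exact ediam_ball_le x ρ
  exact this s

/-- Segments of length `2 r` have measure at most `2 r`. -/
theorem hausdorffOne_segment_le (p u : Plane) (hu : ‖u‖ = 1) {r : ℝ} (hr : 0 < r) :
    hausdorffOne ((fun t : ℝ => p + t • u) '' Icc (-r) r) ≤ ENNReal.ofReal (2 * r) := by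
  have hm : MeasurableSet ((fun t : ℝ => p + t • u) '' Icc (-r) r) :=
    (isCompact_Icc.image (by fun_prop)).measurableSet
  rw [hausdorffOne_apply hm]
  simp only [OuterMeasure.mkMetric', OuterMeasure.iSup_apply]
  refine iSup₂_le fun ε hε => ?_
  have hlim : Tendsto (fun N : ℕ => 2 * r * (1 + 1 / ((N : ℝ) + 1))) atTop (𝓝 (2 * r * (1 + 0))) :=
    (tendsto_one_div_add_atTop_nhds_zero_nat.const_add 1).const_mul _
  have hlim' := ENNReal.tendsto_ofReal hlim
  rw [add_zero, mul_one] at hlim'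
  have hsmall : Tendsto (fun N : ℕ => ENNReal.ofReal
      (2 * (r * (1 + 1 / ((N : ℝ) + 1)) * (1 / ((N : ℝ) + 1))))) atTop (𝓝 0) := by
    have h : Tendsto (fun N : ℕ => 2 * (r * (1 + 1 / ((N : ℝ) + 1)) * (1 / ((N : ℝ) + 1))))
        atTop (𝓝 (2 * (r * (1 + 0) * 0))) :=
      (((tendsto_one_div_add_atTop_nhds_zero_nat.const_add 1).const_mul _).mul
        tendsto_one_div_add_atTop_nhds_zero_nat).const_mul _
    simpa using ENNReal.tendsto_ofReal h
  refine ge_of_tendsto hlim' ?_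
  filter_upwards [hsmall.eventually_lt_const hε] with N hN
  set M : ℝ := (N : ℝ) + 1 with hM
  have hM0 : 0 < M := by positivity
  -- The segment is cut into `M = N + 1` pieces of half-length `r / M`. The factor `1 + 1 / M` lets
  -- open balls cover the closed pieces, at total cost `2r(1 + 1 / M)`.
  set ρ := r * (1 + 1 / M) * (1 / M) with hρ
  have hρ0 : 0 < ρ := by positivity
  have hcover : (fun t : ℝ => p + t • u) '' Icc (-r) r ⊆
      ⋃ i ∈ Finset.range (N + 1), Metric.ball (p + (-r + (2 * i + 1) * (r / M)) • u) ρ := by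
    rintro _ ⟨t, ⟨ht1, ht2⟩, rfl⟩
    simp only [mem_iUnion, Finset.mem_range, Metric.mem_ball]
    have hd : ∀ c : ℝ, dist (p + t • u) (p + c • u) = |t - c| := by
      intro c
      rw [dist_add_left, dist_eq_norm, ← sub_smul, norm_smul, hu, mul_one, Real.norm_eq_abs]
    set q := (t + r) / (2 * (r / M)) with hq
    have hq0 : 0 ≤ q := div_nonneg (by linarith) (by positivity)
    have hqt : t = -r + 2 * q * (r / M) := by rw [hq]; field_simp; ring
    have hrM : 0 < r / M := by positivity
    have hqM : q ≤ M := by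
      rw [hq, div_le_iff₀ (by positivity)]
      have : M * (2 * (r / M)) = 2 * r := by field_simp
      linarith
    have hρr : r / M < ρ := by
      have : ρ = r / M + r / M * (1 / M) := by rw [hρ]; ring
      have : 0 < r / M * (1 / M) := by positivity
      linarith
    -- The endpoint `t = r` has `q = N + 1`, one past the last piece; the minimum assigns it to
    -- piece `N`.
    refine ⟨min ⌊q⌋₊ N, Nat.lt_succ_of_le (min_le_right _ _), ?_⟩
    rw [hd]
    refine lt_of_le_of_lt ?_ hρr
    have hfl : (⌊q⌋₊ : ℝ) ≤ q := Nat.floor_le hq0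
    have hfl2 : q < ⌊q⌋₊ + 1 := Nat.lt_floor_add_one q
    have h1 : ((min ⌊q⌋₊ N : ℕ) : ℝ) ≤ q := le_trans (by exact_mod_cast min_le_left _ _) hfl
    have h2 : q ≤ (min ⌊q⌋₊ N : ℕ) + 1 := by
      rcases min_choice ⌊q⌋₊ N with h | h <;> rw [h]
      · exact hfl2.le
      · exact hqM
    have : t - (-r + (2 * ((min ⌊q⌋₊ N : ℕ) : ℝ) + 1) * (r / M)) =
        (2 * (q - (min ⌊q⌋₊ N : ℕ)) - 1) * (r / M) := by rw [hqt]; ring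
    rw [this, abs_mul, abs_of_pos hrM]
    refine mul_le_of_le_one_left hrM.le ?_
    rw [abs_le]; constructor <;> linarith
  calc OuterMeasure.mkMetric'.pre ballCost ε ((fun t : ℝ => p + t • u) '' Icc (-r) r)
      ≤ OuterMeasure.mkMetric'.pre ballCost ε (⋃ i ∈ Finset.range (N + 1),
          Metric.ball (p + (-r + (2 * i + 1) * (r / M)) • u) ρ) := measure_mono hcover
    _ ≤ ∑ i ∈ Finset.range (N + 1), OuterMeasure.mkMetric'.pre ballCost ε
          (Metric.ball (p + (-r + (2 * i + 1) * (r / M)) • u) ρ) :=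
        measure_biUnion_finset_le _ _
    _ ≤ ∑ i ∈ Finset.range (N + 1), ENNReal.ofReal (2 * ρ) := by
        refine Finset.sum_le_sum fun i _ => ?_
        refine (OuterMeasure.mkMetric'.pre_le ?_).trans (ballCost_ball_le _ _)
        exact (ediam_ball_le _ _).trans hN.le
    _ = ENNReal.ofReal (2 * r * (1 + 1 / M)) := by
        rw [Finset.sum_const, Finset.card_range, nsmul_eq_mul, ← ENNReal.ofReal_natCast,
          ← ENNReal.ofReal_mul (by positivity)]
        congr 1
        push_cast
        rw [← hM, hρ]; field_simp

/-- Lines are measured from below by arc length. -/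
theorem volume_le_hausdorffOne_line (p u : Plane) (hu : ‖u‖ = 1) (A : Set ℝ) :
    volume A ≤ hausdorffOne ((fun t : ℝ => p + t • u) '' A) := by
  have hi : Isometry (fun t : ℝ => p + t • u) := by
    refine Isometry.of_dist_eq fun s t => ?_
    rw [dist_add_left, dist_eq_norm, ← sub_smul, norm_smul, hu, mul_one, Real.dist_eq,
      Real.norm_eq_abs]
  rw [← hausdorffMeasure_real, ← hi.hausdorffMeasure_image (Or.inl zero_le_one)]
  exact hausdorffMeasure_le_hausdorffOne _

theorem inner_eq_coord (x y : Plane) : (inner ℝ x y : ℝ) = x 0 * y 0 + x 1 * y 1 := by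
  simp [PiLp.inner_apply, Fin.sum_univ_two, mul_comm]

/-- Rotation by a quarter turn. -/
def quarterTurn (v : Plane) : Plane := !₂[-v 1, v 0]

theorem norm_sq_coord (x : Plane) : ‖x‖ ^ 2 = x 0 ^ 2 + x 1 ^ 2 := by
  simp [EuclideanSpace.norm_sq_eq, Fin.sum_univ_two]

theorem norm_quarterTurn (v : Plane) : ‖quarterTurn v‖ = ‖v‖ := by
  rw [← sq_eq_sq₀ (norm_nonneg _) (norm_nonneg _), norm_sq_coord, norm_sq_coord]
  simp [quarterTurn]; ring

/-- The unit direction of the lines orthogonal to `v`. -/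
def lineDir (v : Plane) : Plane := ‖v‖⁻¹ • quarterTurn v

theorem norm_lineDir {v : Plane} (hv : v ≠ 0) : ‖lineDir v‖ = 1 := by
  rw [lineDir, norm_smul, norm_quarterTurn, norm_inv, norm_norm,
    inv_mul_cancel₀ (norm_ne_zero_iff.2 hv)]

theorem inner_lineDir_self (v : Plane) : (inner ℝ (lineDir v) v : ℝ) = 0 := by
  simp [inner_eq_coord, lineDir, quarterTurn]; ring

/-- Orthogonal decomposition along `v` and the direction orthogonal to it. -/
theorem eq_smul_add_smul_lineDir {v : Plane} (hv : v ≠ 0) (y : Plane) :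
    y = ((inner ℝ y v : ℝ) * (‖v‖ ^ 2)⁻¹) • v + (inner ℝ y (lineDir v) : ℝ) • lineDir v := by
  have hn : ‖v‖ ≠ 0 := norm_ne_zero_iff.2 hv
  have h2 : v 0 ^ 2 + v 1 ^ 2 ≠ 0 := by rw [← norm_sq_coord]; positivity
  have hi : ‖v‖⁻¹ * ‖v‖⁻¹ = (v 0 ^ 2 + v 1 ^ 2)⁻¹ := by
    rw [← norm_sq_coord, ← mul_inv, sq]
  have hS := mul_inv_cancel₀ h2
  ext i
  fin_cases i
  all_goals simp only [inner_eq_coord, lineDir, quarterTurn, PiLp.add_apply, PiLp.smul_apply, smul_eq_mul,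
      norm_sq_coord, Fin.zero_eta, Fin.mk_one, Matrix.cons_val_zero,
      Matrix.cons_val_one]
  · linear_combination (-y 0 * v 1 ^ 2 + v 0 * v 1 * y 1) * hi - y 0 * hS
  · linear_combination (-y 1 * v 0 ^ 2 + v 0 * v 1 * y 0) * hi - y 1 * hS

theorem line_inter_ball_subset {v : Plane} (hv : v ≠ 0) (x : Plane) (r : ℝ) (c : ℝ) :
    ∃ p u : Plane, ‖u‖ = 1 ∧ {y : Plane | inner ℝ y v = c} ∩ Metric.ball x r ⊆
      (fun t : ℝ => p + t • u) '' Icc (-r) r := by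
  refine ⟨(c * (‖v‖ ^ 2)⁻¹) • v + (inner ℝ x (lineDir v) : ℝ) • lineDir v, lineDir v,
    norm_lineDir hv, ?_⟩
  rintro y ⟨hy, hyx⟩
  refine ⟨inner ℝ (y - x) (lineDir v), ?_, ?_⟩
  · rw [mem_Icc, ← abs_le]
    refine (abs_real_inner_le_norm _ _).trans ?_
    rw [norm_lineDir hv, mul_one, ← dist_eq_norm]
    exact (Metric.mem_ball.1 hyx).le
  · have := eq_smul_add_smul_lineDir hv y
    simp only [mem_ofPred_eq] at hy
    rw [hy] at this
    simp only
    rw [add_assoc, ← add_smul, ← inner_add_left, add_sub_cancel]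
    exact this.symm

theorem hausdorffOne_line_inter_ball_le {v : Plane} (hv : v ≠ 0) (x : Plane) {r : ℝ} (hr : 0 < r)
    (c : ℝ) : hausdorffOne ({y : Plane | inner ℝ y v = c} ∩ Metric.ball x r) ≤
      ENNReal.ofReal (2 * r) := by
  obtain ⟨p, u, hu, h⟩ := line_inter_ball_subset hv x r c
  exact (measure_mono h).trans (hausdorffOne_segment_le p u hu hr)

/-! ### Products of plane waves and their spectrum. -/

section Wave

variable {ι : Type*} [Fintype ι]

/-- A product of plane cosine waves with frequencies `v i`. -/
def wave (v : ι → Plane) (x : Plane) : ℂ :=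
  ((∏ i, Real.cos (2 * Real.pi * inner ℝ x (v i)) : ℝ) : ℂ)

theorem continuous_wave (v : ι → Plane) : Continuous (wave v) := by
  unfold wave
  fun_prop

theorem wave_zero (v : ι → Plane) : wave v 0 = 1 := by simp [wave]

theorem norm_wave_le (v : ι → Plane) (x : Plane) : ‖wave v x‖ ≤ 1 := by
  rw [wave, Complex.norm_real, Real.norm_eq_abs, Finset.abs_prod]
  exact Finset.prod_le_one (fun _ _ => abs_nonneg _) fun _ _ => Real.abs_cos_le_one _

theorem memLp_wave (v : ι → Plane) : MemLp (wave v) ∞ (volume : Measure Plane) :=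
  memLp_top_of_bound (continuous_wave v).aestronglyMeasurable 1
    (Eventually.of_forall (norm_wave_le v))

theorem eLpNorm_wave (v : ι → Plane) : eLpNorm (wave v) ∞ (volume : Measure Plane) = 1 := by
  refine le_antisymm ?_ ?_
  · rw [eLpNorm_exponent_top]
    refine eLpNormEssSup_le_of_ae_enorm_bound (Eventually.of_forall fun x => ?_)
    rw [← ofReal_norm, ← ENNReal.ofReal_one]
    exact ENNReal.ofReal_le_ofReal (norm_wave_le v x)
  -- The points where `|wave v|` exceeds its essential supremum would form an open null set
  -- containing `0`.
  · by_contra! h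
    rw [eLpNorm_exponent_top] at h
    have hae := enorm_ae_le_eLpNormEssSup (wave v) (volume : Measure Plane)
    have hopen : IsOpen {x | eLpNormEssSup (wave v) (volume : Measure Plane) < ‖wave v x‖ₑ} :=
      isOpen_lt continuous_const (continuous_wave v).enorm
    have hpos := hopen.measure_pos volume ⟨0, by simpa [wave_zero] using h⟩
    refine hpos.ne' ?_
    rw [ae_iff] at hae
    simpa using hae

/-- Euler's formula for each factor, then expansion of the product; `t` is the set of indices that
contribute the plus sign. -/
theorem wave_eq_sum [DecidableEq ι] (v : ι → Plane) (x : Plane) :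
    wave v x = ∑ t : Finset ι, (1 / 2 : ℂ) ^ Fintype.card ι *
      Complex.exp (((2 * Real.pi * inner ℝ x (∑ i, (if i ∈ t then (1 : ℝ) else -1) • v i) : ℝ) : ℂ)
        * Complex.I) := by
  rw [wave, Complex.ofReal_prod]
  have h : ∀ i, ((Real.cos (2 * Real.pi * inner ℝ x (v i)) : ℝ) : ℂ) =
      (1 / 2) * Complex.exp (((2 * Real.pi * inner ℝ x (v i) : ℝ) : ℂ) * Complex.I) +
      (1 / 2) * Complex.exp (-((2 * Real.pi * inner ℝ x (v i) : ℝ) : ℂ) * Complex.I) := by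
    intro i
    rw [Complex.ofReal_cos, Complex.cos]
    ring
  simp_rw [h]
  rw [Fintype.prod_add]
  refine Finset.sum_congr rfl fun t _ => ?_
  rw [Finset.prod_mul_distrib, Finset.prod_mul_distrib, ← Complex.exp_sum, ← Complex.exp_sum,
    Finset.prod_const, Finset.prod_const, mul_mul_mul_comm, ← pow_add, Finset.card_add_card_compl,
    ← Complex.exp_add]
  congr 2
  rw [inner_sum, Finset.mul_sum, Complex.ofReal_sum, Finset.sum_mul,
    ← Finset.sum_add_sum_compl t]
  congr 1
  · refine Finset.sum_congr rfl fun i hi => ?_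
    simp [hi]
  · refine Finset.sum_congr rfl fun i hi => ?_
    rw [Finset.mem_compl] at hi
    simp [hi]

/-- Fourier inversion: in the chosen normalization the transform of `exp (2πi⟨x, l⟩)` is the Dirac
mass at `-l`. -/
theorem integral_fourierInv_mul_exp (g : 𝓢(Plane, ℂ)) (l : Plane) :
    ∫ x, (𝓕⁻ g) x * Complex.exp (((2 * Real.pi * inner ℝ x l : ℝ) : ℂ) * Complex.I) = g (-l) := by
  have h : 𝓕 (𝓕⁻ g) (-l) = g (-l) := by
    rw [FourierTransform.fourier_fourierInv_eq]
  rw [← h, SchwartzMap.fourier_coe, Real.fourier_eq']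
  refine integral_congr_ae (Eventually.of_forall fun x => ?_)
  simp only [smul_eq_mul, inner_neg_right]
  rw [mul_comm]
  congr 3
  ring_nf

theorem integrable_fourierInv_mul_exp (g : 𝓢(Plane, ℂ)) (l : Plane) :
    Integrable fun x : Plane =>
      (𝓕⁻ g) x * Complex.exp (((2 * Real.pi * inner ℝ x l : ℝ) : ℂ) * Complex.I) := by
  refine (𝓕⁻ g).integrable.mul_bdd (c := 1) ?_ (Eventually.of_forall fun x => ?_)
  · exact (by fun_prop : Continuous fun x : Plane =>
      Complex.exp (((2 * Real.pi * inner ℝ x l : ℝ) : ℂ) * Complex.I)).aestronglyMeasurable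
  · rw [Complex.norm_exp_ofReal_mul_I]

/-- The spectrum of a product of waves consists of the signed sums of its frequencies. -/
theorem wave_mem_paleyWiener {K : Set Plane} (hK : IsClosed K) (v : ι → Plane)
    (hv : ∀ σ : ι → ℝ, (∀ i, σ i = 1 ∨ σ i = -1) → ∑ i, σ i • v i ∈ K) :
    wave v ∈ PaleyWiener ∞ K := by
  classical
  refine ⟨continuous_wave v, memLp_wave v, ?_⟩
  -- As `K` is closed, it is enough that the transform annihilates test functions supported off `K`.
  refine sInter_subset_of_mem ⟨fun g hg => ?_, hK⟩
  rw [TemperedDistribution.fourierInv_apply, Lp.toTemperedDistribution_apply]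
  have h1 : ∫ x, (𝓕⁻ g) x • ((memLp_wave v).toLp (wave v)) x =
      ∫ x, (𝓕⁻ g) x * wave v x := by
    refine integral_congr_ae ?_
    filter_upwards [(memLp_wave v).coeFn_toLp] with x hx
    rw [hx, smul_eq_mul]
  rw [h1]
  simp_rw [wave_eq_sum, Finset.mul_sum, mul_left_comm]
  rw [integral_finsetSum _ fun t _ => (integrable_fourierInv_mul_exp g _).const_mul _]
  refine Finset.sum_eq_zero fun t _ => ?_
  rw [integral_const_mul, integral_fourierInv_mul_exp]
  -- The Dirac masses sit at negatives of signed sums, which are again signed sums.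
  have hmem : -∑ i, (if i ∈ t then (1 : ℝ) else -1) • v i ∈ K := by
    rw [← Finset.sum_neg_distrib]
    simp_rw [← neg_smul]
    refine hv (fun i => -(if i ∈ t then (1 : ℝ) else -1)) fun i => ?_
    by_cases hi : i ∈ t <;> simp [hi]
  have : g (-∑ i, (if i ∈ t then (1 : ℝ) else -1) • v i) = 0 :=
    image_eq_zero_of_notMem_tsupport fun h => hg h hmem
  rw [this, mul_zero]

end Wave

/-! ### Unit vectors, support function and mean width. -/

/-- The unit vector with angle `t`. -/
def circ (t : ℝ) : Plane := !₂[Real.cos t, Real.sin t]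

theorem inner_circ_circ (s t : ℝ) : (inner ℝ (circ s) (circ t) : ℝ) = Real.cos (s - t) := by
  simp [inner_eq_coord, circ, Real.cos_sub]

theorem norm_circ (t : ℝ) : ‖circ t‖ = 1 := by
  rw [← sq_eq_sq₀ (norm_nonneg _) zero_le_one, norm_sq_coord]
  simp [circ]

theorem circ_add_pi (t : ℝ) : circ (t + Real.pi) = -circ t := by
  ext i; fin_cases i <;> simp [circ]

theorem continuous_circ : Continuous circ := by
  unfold circ
  fun_prop

/-- The difference of two unit vectors is twice the sine of the half angle, times a unit vector. -/
theorem circ_sub_circ (a b : ℝ) : circ (a - b + Real.pi / 2) - circ (a + b + Real.pi / 2) =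
    (2 * Real.sin b) • circ a := by
  ext i
  fin_cases i
  · simp [circ, Real.cos_add, Real.sin_add, Real.sin_sub]; ring
  · simp [circ, Real.sin_add, Real.cos_add, Real.cos_sub]; ring

theorem norm_circ_sub_circ_le (s t : ℝ) : ‖circ s - circ t‖ ≤ |s - t| := by
  have h := circ_sub_circ ((s + t) / 2 - Real.pi / 2) ((t - s) / 2)
  rw [show (s + t) / 2 - Real.pi / 2 - (t - s) / 2 + Real.pi / 2 = s by ring,
    show (s + t) / 2 - Real.pi / 2 + (t - s) / 2 + Real.pi / 2 = t by ring] at h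
  rw [h, norm_smul, norm_circ, mul_one, Real.norm_eq_abs, abs_mul, abs_two]
  have := Real.abs_sin_le_abs (x := (t - s) / 2)
  rw [abs_div, abs_two, abs_sub_comm] at this
  linarith

section Support

variable {K : Set Plane}

theorem bddAbove_inner_image (hK : IsCompact K) (θ : Plane) :
    BddAbove ((fun x : Plane => (inner ℝ x θ : ℝ)) '' K) :=
  (hK.image (by fun_prop)).bddAbove

theorem inner_le_supportFun (hK : IsCompact K) {x : Plane} (hx : x ∈ K) (θ : Plane) :
    inner ℝ x θ ≤ supportFun K θ :=
  le_csSup (bddAbove_inner_image hK θ) ⟨x, hx, rfl⟩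

theorem exists_inner_eq_supportFun (hK : IsCompact K) (hne : K.Nonempty) (θ : Plane) :
    ∃ x ∈ K, inner ℝ x θ = supportFun K θ := by
  obtain ⟨x, hx, h⟩ := (hK.image (f := fun x : Plane => (inner ℝ x θ : ℝ))
    (by fun_prop)).sSup_mem (hne.image _)
  exact ⟨x, hx, h⟩

theorem neg_mem_of_isQuarterTurnBody (hK : IsQuarterTurnBody K) {x : Plane} (hx : x ∈ K) :
    -x ∈ K := by
  have e : ∀ y : Plane, !₂[y 0, y 1] = y := fun y => by ext i; fin_cases i <;> simp
  have h := (hK.quarter_turn _ _).1 ((hK.quarter_turn (x 0) (x 1)).1 (by rwa [e]))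
  convert! h using 1
  ext i; fin_cases i <;> simp

theorem supportFun_neg (hK : IsQuarterTurnBody K) (θ : Plane) :
    supportFun K (-θ) = supportFun K θ := by
  unfold supportFun
  congr 1
  ext r
  constructor
  · rintro ⟨x, hx, rfl⟩
    exact ⟨-x, neg_mem_of_isQuarterTurnBody hK hx, by simp⟩
  · rintro ⟨x, hx, rfl⟩
    exact ⟨-x, neg_mem_of_isQuarterTurnBody hK hx, by simp⟩

theorem supportFun_smul (hK : IsCompact K) (hne : K.Nonempty) (c : ℝ) (θ : Plane) :
    c * supportFun K θ ≤ supportFun K (c • θ) := by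
  obtain ⟨x, hx, h⟩ := exists_inner_eq_supportFun hK hne θ
  rw [← h, ← real_inner_smul_right]
  exact inner_le_supportFun hK hx _

theorem supportFun_sub_le (hK : IsCompact K) (hne : K.Nonempty) {R : ℝ}
    (hR : ∀ x ∈ K, ‖x‖ ≤ R) (a b : Plane) :
    supportFun K a - supportFun K b ≤ R * ‖a - b‖ := by
  obtain ⟨x, hx, h⟩ := exists_inner_eq_supportFun hK hne a
  have h1 := inner_le_supportFun hK hx b
  have h2 : (inner ℝ x (a - b) : ℝ) ≤ R * ‖a - b‖ :=
    (real_inner_le_norm _ _).trans (mul_le_mul_of_nonneg_right (hR x hx) (norm_nonneg _))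
  rw [inner_sub_right] at h2
  linarith

theorem continuous_supportFun (hK : IsCompact K) (hne : K.Nonempty) :
    Continuous (supportFun K) := by
  obtain ⟨R, hR⟩ := hK.isBounded.exists_norm_le
  have hR0 : 0 ≤ R := by
    obtain ⟨x, hx⟩ := hne
    exact (norm_nonneg x).trans (hR x hx)
  refine (LipschitzWith.of_dist_le_mul (K := R.toNNReal) fun a b => ?_).continuous
  rw [Real.coe_toNNReal _ hR0, dist_eq_norm a b, Real.dist_eq, abs_sub_le_iff]
  refine ⟨supportFun_sub_le hK hne hR a b, ?_⟩
  rw [norm_sub_rev]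
  exact supportFun_sub_le hK hne hR b a

theorem mem_of_inner_le_supportFun (hK : IsCompact K) (hc : Convex ℝ K) {x : Plane}
    (hx : ∀ θ, inner ℝ x θ ≤ supportFun K θ) (hne : K.Nonempty) : x ∈ K := by
  by_contra h
  obtain ⟨f, u, hu, hfx⟩ := geometric_hahn_banach_closed_point hc hK.isClosed h
  obtain ⟨θ, hθ⟩ := (InnerProductSpace.toDual ℝ Plane).surjective f
  have hf : ∀ y, f y = inner ℝ y θ := fun y => by
    rw [← hθ, InnerProductSpace.toDual_apply_apply, real_inner_comm]
  obtain ⟨y, hy, hyθ⟩ := exists_inner_eq_supportFun hK hne θ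
  have := hu y hy
  rw [hf] at this hfx
  have := hx θ
  linarith

theorem zero_mem_interior (hK : IsQuarterTurnBody K) : (0 : Plane) ∈ interior K := by
  obtain ⟨x, hx⟩ := hK.interior_nonempty
  have hneg : -x ∈ interior K := by
    have : Neg.neg ⁻¹' interior K ⊆ interior K := by
      refine interior_maximal (fun y hy => ?_) (isOpen_interior.preimage continuous_neg)
      simpa using neg_mem_of_isQuarterTurnBody hK (interior_subset hy)
    exact this (by simpa using hx)
  have := hK.convex.interior hx hneg (by norm_num : (0 : ℝ) ≤ 1 / 2)
    (by norm_num : (0 : ℝ) ≤ 1 / 2) (by norm_num)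
  simpa using this

/-- Makes `(π/2 - δ) W(K)` strictly smaller than `π/2 · W(K)`, which leaves room for approximation.
-/
theorem meanWidth_pos (hK : IsQuarterTurnBody K) : 0 < meanWidth K := by
  obtain ⟨ρ, hρ, hball⟩ := Metric.isOpen_iff.1 isOpen_interior 0 (zero_mem_interior hK)
  have hne : K.Nonempty := hK.interior_nonempty.mono interior_subset
  have hlow : ∀ t, ρ / 2 ≤ supportFun K (circ t) := fun t => by
    have hmem : (ρ / 2) • circ t ∈ K := by
      refine interior_subset (hball ?_)
      rw [mem_ball_zero_iff, norm_smul, norm_circ, mul_one, Real.norm_eq_abs,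
        abs_of_pos (by positivity)]
      linarith
    have := inner_le_supportFun hK.isCompact hmem (circ t)
    rwa [real_inner_smul_left, inner_circ_circ, sub_self, Real.cos_zero, mul_one] at this
  have hpi := Real.pi_pos
  refine mul_pos (by positivity) ?_
  refine intervalIntegral.intervalIntegral_pos_of_pos
    (Continuous.intervalIntegrable ?_ _ _) (fun t => ?_) (by positivity)
  · exact (continuous_supportFun hK.isCompact hne).comp continuous_circ
  · exact lt_of_lt_of_le (by positivity) (hlow t)

/-- The support function is even, so a half circle carries half of the integral. -/
theorem integral_supportFun (hK : IsQuarterTurnBody K) :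
    ∫ t in (0 : ℝ)..Real.pi, supportFun K (circ t) = Real.pi / 2 * meanWidth K := by
  have hne : K.Nonempty := hK.interior_nonempty.mono interior_subset
  have hc : Continuous fun t => supportFun K (circ t) :=
    (continuous_supportFun hK.isCompact hne).comp continuous_circ
  have h2 : ∫ t in Real.pi..(2 * Real.pi), supportFun K (circ t) =
      ∫ t in (0 : ℝ)..Real.pi, supportFun K (circ t) := by
    have := intervalIntegral.integral_comp_add_right (a := 0) (b := Real.pi)
      (fun t => supportFun K (circ t)) Real.pi
    rw [zero_add, ← two_mul] at this
    rw [← this]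
    simp_rw [circ_add_pi, supportFun_neg hK]
  have h := intervalIntegral.integral_add_adjacent_intervals
    (hc.intervalIntegrable (μ := volume) 0 Real.pi) (hc.intervalIntegrable Real.pi (2 * Real.pi))
  rw [h2] at h
  have hm : meanWidth K = (2 / (2 * Real.pi)) * ∫ t in (0 : ℝ)..(2 * Real.pi),
    supportFun K (circ t) := rfl
  rw [hm, ← h]
  field_simp
  norm_num

end Support

/-! ### Inscribed polygons and zonotopes. -/

/-- Total variation of a sequence with one peak. The step from `m` to `m + 1` may go either way,
since the peak is only located up to one step. -/
theorem sum_abs_sub_of_unimodal (F : ℕ → ℝ) {m n : ℕ} (hm : m < n)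
    (hup : ∀ j < m, F j ≤ F (j + 1)) (hdown : ∀ j, m < j → j < n → F (j + 1) ≤ F j) :
    ∑ j ∈ Finset.range n, |F (j + 1) - F j| =
      F m - F 0 + |F (m + 1) - F m| + (F (m + 1) - F n) := by
  obtain ⟨k, rfl⟩ : ∃ k, n = m + 1 + k := ⟨n - (m + 1), by omega⟩
  rw [Finset.sum_range_add, Finset.sum_range_succ]
  congr 1
  · congr 1
    rw [← Finset.sum_range_sub]
    refine Finset.sum_congr rfl fun j hj => abs_of_nonneg ?_
    linarith [hup j (Finset.mem_range.1 hj)]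
  · have h := Finset.sum_range_sub' (fun j => F (m + 1 + j)) k
    simp only [add_zero] at h
    rw [← h]
    refine Finset.sum_congr rfl fun j hj => ?_
    have := hdown (m + 1 + j) (by omega) (by have := Finset.mem_range.1 hj; omega)
    rw [abs_of_nonpos (by linarith), neg_sub, add_assoc (m + 1) j 1]

/-- Expresses a direction through two consecutive sampling directions, against which the sign of an
edge is known. -/
theorem sin_sub_smul_circ (a b t : ℝ) : Real.sin (b - a) • circ t =
    Real.sin (t - a) • circ b - Real.sin (t - b) • circ a := by
  ext i
  fin_cases i
  · simp [circ, Real.sin_sub]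
    ring
  · simp [circ, Real.sin_sub]
    ring

theorem exists_eq_smul_circ_of_mem_Icc (x : Plane) :
    ∃ t ∈ Icc 0 Real.pi, x = ‖x‖ • circ t ∨ x = -(‖x‖ • circ t) := by
  have h0 : ‖(⟨x 0, x 1⟩ : ℂ)‖ = ‖x‖ := by
    rw [← sq_eq_sq₀ (norm_nonneg _) (norm_nonneg _), norm_sq_coord, Complex.sq_norm,
      Complex.normSq_mk]
    ring
  have hx : x = ‖x‖ • circ (Complex.arg ⟨x 0, x 1⟩) := by
    ext i
    fin_cases i
    · simp [circ, ← h0, Complex.norm_mul_cos_arg]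
    · simp [circ, ← h0, Complex.norm_mul_sin_arg]
  rcases le_or_gt 0 (Complex.arg ⟨x 0, x 1⟩) with h | h
  · exact ⟨_, ⟨h, Complex.arg_le_pi _⟩, Or.inl hx⟩
  · refine ⟨Complex.arg ⟨x 0, x 1⟩ + Real.pi, ⟨?_, by linarith⟩, Or.inr ?_⟩
    · linarith [Complex.neg_pi_lt_arg (⟨x 0, x 1⟩ : ℂ)]
    · rw [circ_add_pi, smul_neg, neg_neg]
      exact hx

section InscribedPolygon

variable {K : Set Plane} {n : ℕ} {p : ℕ → Plane} {h : ℝ}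

/-- The edges of half of a symmetric inscribed polygon generate a zonotope contained in `K`. -/
theorem sum_abs_inner_edge_le (hK : IsQuarterTurnBody K) (hn : 2 ≤ n) (hh : n * h = Real.pi)
    (hp : ∀ j ≤ n, p j ∈ K)
    (hmax : ∀ j ≤ n, inner ℝ (p j) (circ (j * h)) = supportFun K (circ (j * h)))
    (hpn : p n = -p 0) (θ : Plane) :
    ∑ j ∈ Finset.range n, |(inner ℝ ((1 / 2 : ℝ) • (p (j + 1) - p j)) θ : ℝ)| ≤
      supportFun K θ := by
  have hpi := Real.pi_pos
  have hn' : (2 : ℝ) ≤ n := by exact_mod_cast hn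
  have hh0 : 0 < h := by
    by_contra! hneg
    nlinarith
  have hsin : 0 < Real.sin h := Real.sin_pos_of_pos_of_lt_pi hh0 (by nlinarith)
  -- Along the half polygon from `p 0` to `p n = -p 0`, the height in direction `t` rises and then
  -- falls, with its peak at `m` or `m + 1` where `m h ≤ t ≤ (m + 1) h`.
  have key : ∀ t ∈ Icc 0 Real.pi,
      ∑ j ∈ Finset.range n, |(inner ℝ (p (j + 1)) (circ t) : ℝ) - inner ℝ (p j) (circ t)| ≤
        2 * supportFun K (circ t) := by
    rintro t ⟨ht0, htpi⟩
    have hm : ∃ m < n, m * h ≤ t ∧ t ≤ (m + 1) * h := by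
      rcases lt_or_ge ⌊t / h⌋₊ n with hlt | hge
      · refine ⟨⌊t / h⌋₊, hlt, ?_, ?_⟩
        · exact (le_div_iff₀ hh0).1 (Nat.floor_le (by positivity))
        · exact ((div_lt_iff₀ hh0).1 (Nat.lt_floor_add_one _)).le
      -- This happens only at `t = π`, which is assigned to the last interval.
      · have h1 : (n : ℝ) ≤ t / h := (Nat.le_floor_iff (by positivity)).1 hge
        rw [le_div_iff₀ hh0] at h1
        refine ⟨n - 1, by omega, ?_, ?_⟩ <;> rw [Nat.cast_sub (by omega)] <;> push_cast <;>
          nlinarith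
    obtain ⟨m, hmn, hm1, hm2⟩ := hm
    have hstep : ∀ j < n, Real.sin h *
        ((inner ℝ (p (j + 1)) (circ t) : ℝ) - inner ℝ (p j) (circ t)) =
        Real.sin (t - j * h) * (inner ℝ (p (j + 1) - p j) (circ ((j + 1 : ℕ) * h))) +
        Real.sin (t - (j + 1 : ℕ) * h) * (-(inner ℝ (p (j + 1) - p j) (circ (j * h)))) := by
      intro j _
      have := sin_sub_smul_circ (j * h) ((j + 1 : ℕ) * h) t
      rw [show ((j + 1 : ℕ) : ℝ) * h - j * h = h by push_cast; ring] at this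
      rw [← inner_sub_left, ← real_inner_smul_right, this, inner_sub_right,
        real_inner_smul_right, real_inner_smul_right]
      ring
    -- Each endpoint of an edge is extremal in its own direction. In `hstep` the sign of the
    -- increment is then decided by the two sines.
    have hA : ∀ j < n, 0 ≤ (inner ℝ (p (j + 1) - p j) (circ ((j + 1 : ℕ) * h)) : ℝ) := by
      intro j hj
      rw [inner_sub_left, hmax (j + 1) hj]
      linarith [inner_le_supportFun hK.isCompact (hp j hj.le) (circ ((j + 1 : ℕ) * h))]
    have hB : ∀ j < n, 0 ≤ -(inner ℝ (p (j + 1) - p j) (circ (j * h)) : ℝ) := by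
      intro j hj
      rw [inner_sub_left, hmax j hj.le]
      linarith [inner_le_supportFun hK.isCompact (hp (j + 1) hj) (circ (j * h))]
    rw [sum_abs_sub_of_unimodal (fun j => (inner ℝ (p j) (circ t) : ℝ)) hmn]
    -- Since `p n = -p 0`, the end terms cancel and the variation is twice the larger of the heights
    -- at `m` and `m + 1`.
    · have e1 := inner_le_supportFun hK.isCompact (hp m hmn.le) (circ t)
      have e2 := inner_le_supportFun hK.isCompact (hp (m + 1) hmn) (circ t)
      simp only [hpn, inner_neg_left]
      rcases abs_cases ((inner ℝ (p (m + 1)) (circ t) : ℝ) - inner ℝ (p m) (circ t)) with h | h <;>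
        linarith [h.1]
    · intro j hj
      have hjm : ((j + 1 : ℕ) : ℝ) ≤ m := by exact_mod_cast hj
      have hjh : 0 ≤ (j : ℝ) * h := by positivity
      have hjh' : ((j + 1 : ℕ) : ℝ) * h ≤ t := (mul_le_mul_of_nonneg_right hjm hh0.le).trans hm1
      have hjh'' : (j : ℝ) * h ≤ ((j + 1 : ℕ) : ℝ) * h := by push_cast; nlinarith
      have := hstep j (by omega)
      have s1 := Real.sin_nonneg_of_nonneg_of_le_pi (x := t - j * h) (by linarith) (by linarith)
      have s2 := Real.sin_nonneg_of_nonneg_of_le_pi (x := t - (j + 1 : ℕ) * h) (by linarith)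
        (by linarith)
      have pos := add_nonneg (mul_nonneg s1 (hA j (by omega))) (mul_nonneg s2 (hB j (by omega)))
      rw [← this] at pos
      have := nonneg_of_mul_nonneg_right pos hsin
      linarith
    · intro j hj hjn
      have hjm : (m : ℝ) + 1 ≤ j := by exact_mod_cast hj
      have hjn' : ((j + 1 : ℕ) : ℝ) ≤ n := by exact_mod_cast hjn
      have hjh' : t ≤ (j : ℝ) * h := hm2.trans (mul_le_mul_of_nonneg_right hjm hh0.le)
      have hjh'' : (j : ℝ) * h ≤ ((j + 1 : ℕ) : ℝ) * h := by push_cast; nlinarith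
      have hjpi : ((j + 1 : ℕ) : ℝ) * h ≤ Real.pi := by
        rw [← hh]; exact mul_le_mul_of_nonneg_right hjn' hh0.le
      have := hstep j hjn
      have s1 := Real.sin_nonpos_of_nonpos_of_neg_pi_le (x := t - j * h) (by linarith)
        (by linarith)
      have s2 := Real.sin_nonpos_of_nonpos_of_neg_pi_le (x := t - (j + 1 : ℕ) * h)
        (by linarith) (by linarith)
      have neg := add_nonpos (mul_nonpos_of_nonpos_of_nonneg s1 (hA j hjn))
        (mul_nonpos_of_nonpos_of_nonneg s2 (hB j hjn))
      rw [← this] at neg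
      have := nonpos_of_mul_nonpos_right neg hsin
      linarith
  obtain ⟨t, ht, hθ⟩ := exists_eq_smul_circ_of_mem_Icc θ
  have hne : K.Nonempty := ⟨_, hp 0 (Nat.zero_le _)⟩
  have hS : ‖θ‖ * supportFun K (circ t) ≤ supportFun K θ := by
    refine (supportFun_smul hK.isCompact hne ‖θ‖ (circ t)).trans_eq ?_
    rcases hθ with h | h
    · rw [← h]
    · rw [← supportFun_neg hK, ← h]
  refine le_trans ?_ hS
  have habs : ∀ y : Plane, |(inner ℝ y θ : ℝ)| = ‖θ‖ * |(inner ℝ y (circ t) : ℝ)| := by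
    intro y
    rcases hθ with h | h
    · conv_lhs => rw [h, real_inner_smul_right, abs_mul, abs_norm]
    · conv_lhs => rw [h, inner_neg_right, abs_neg, real_inner_smul_right, abs_mul, abs_norm]
  simp_rw [habs, real_inner_smul_left, abs_mul, inner_sub_left]
  rw [← Finset.mul_sum, ← Finset.mul_sum]
  refine mul_le_mul_of_nonneg_left ?_ (norm_nonneg _)
  have := key t ht
  rw [abs_of_pos (by norm_num : (0 : ℝ) < 1 / 2)]
  linarith

/-- The perimeter of an inscribed polygon is at least a Riemann sum of the support function. -/
theorem le_sum_norm_edge (hh : n * h = Real.pi)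
    (hmax : ∀ j ≤ n, inner ℝ (p j) (circ (j * h)) = supportFun K (circ (j * h)))
    (hpn : p n = -p 0) :
    2 * Real.sin (h / 2) * ∑ j ∈ Finset.range n, supportFun K (circ (j * h)) ≤
      ∑ j ∈ Finset.range n, ‖p (j + 1) - p j‖ := by
  -- `τ (j + 1)` is orthogonal to the direction midway between those of `p j` and `p (j + 1)`. The
  -- edge is at least as long as its component along it, and summation by parts leaves `⟨p j, τ j -
  -- τ (j + 1)⟩`, where the difference is `2 sin (h / 2)` times the direction of `p j`.
  set τ : ℕ → Plane := fun j => circ (j * h - h / 2 + Real.pi / 2) with hτ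
  set G : ℕ → ℝ := fun j => inner ℝ (p j) (τ j) with hG
  have hG0 : G n - G 0 = 0 := by
    have : τ n = -τ 0 := by
      simp only [hτ]
      rw [hh, ← circ_add_pi]
      congr 1
      push_cast
      ring
    simp only [hG]
    rw [this, hpn, inner_neg_neg, sub_self]
  have hstep : ∀ j < n, (inner ℝ (p (j + 1) - p j) (τ (j + 1)) : ℝ) =
      (G (j + 1) - G j) + 2 * Real.sin (h / 2) * supportFun K (circ (j * h)) := by
    intro j hj
    have e := circ_sub_circ (j * h) (h / 2)
    have e' : τ (j + 1) = τ j - (2 * Real.sin (h / 2)) • circ (j * h) := by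
      rw [← e]
      simp only [hτ]
      rw [sub_sub_cancel]
      congr 1
      push_cast
      ring
    rw [← hmax j hj.le, ← real_inner_smul_right, inner_sub_left]
    simp only [hG]
    conv_lhs => rw [e', inner_sub_right (p j), ← e']
    ring
  calc _ = ∑ j ∈ Finset.range n, (inner ℝ (p (j + 1) - p j) (τ (j + 1)) : ℝ) := by
        rw [Finset.sum_congr rfl fun j hj => hstep j (Finset.mem_range.1 hj),
          Finset.sum_add_distrib, Finset.sum_range_sub, hG0, zero_add, Finset.mul_sum]
    _ ≤ _ := by
        refine Finset.sum_le_sum fun j _ => (real_inner_le_norm _ _).trans_eq ?_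
        rw [norm_circ, mul_one]

end InscribedPolygon

theorem integral_le_riemann_sum {g : ℝ → ℝ} (hg : Continuous g) {R : ℝ}
    (hR : ∀ s t, g t ≤ g s + R * |t - s|) (hR0 : 0 ≤ R) (n : ℕ) {h : ℝ} (hh : 0 ≤ h) :
    ∫ t in (0 : ℝ)..(n * h), g t ≤
      h * ∑ j ∈ Finset.range n, g (j * h) + n * h * (R * h) := by
  have hs := intervalIntegral.sum_integral_adjacent_intervals (μ := volume) (f := g)
    (a := fun j : ℕ => (j : ℝ) * h) (n := n) fun k _ => hg.intervalIntegrable _ _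
  simp only [Nat.cast_zero, zero_mul] at hs
  rw [← hs]
  have : h * ∑ j ∈ Finset.range n, g (j * h) + n * h * (R * h) =
      ∑ j ∈ Finset.range n, h * (g (j * h) + R * h) := by
    simp only [mul_add, Finset.sum_add_distrib, Finset.mul_sum, Finset.sum_const,
      Finset.card_range, nsmul_eq_mul]
    ring
  rw [this]
  refine Finset.sum_le_sum fun j _ => ?_
  have hle : (j : ℝ) * h ≤ (j + 1 : ℕ) * h := by push_cast; nlinarith
  have hlen : ((j + 1 : ℕ) : ℝ) * h - j * h = h := by push_cast; ring
  calc ∫ t in ((j : ℝ) * h)..((j + 1 : ℕ) * h), g t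
      ≤ ∫ _ in ((j : ℝ) * h)..((j + 1 : ℕ) * h), (g (j * h) + R * h) := by
        refine intervalIntegral.integral_mono_on hle (hg.intervalIntegrable _ _)
          intervalIntegrable_const fun t ht => (hR (j * h) t).trans ?_
        rw [abs_of_nonneg (by linarith [ht.1])]
        have := mul_le_mul_of_nonneg_left (a := R) (by linarith [ht.2] : t - j * h ≤ h) hR0
        linarith
    _ = h * (g (j * h) + R * h) := by
        rw [intervalIntegral.integral_const, hlen, smul_eq_mul]

/-- Zonotopes inscribed in `K` have nearly the mean width of `K`. -/
theorem exists_inscribed_zonotope {K : Set Plane} (hK : IsQuarterTurnBody K) {L : ℝ}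
    (hL : L < Real.pi / 2 * meanWidth K) : ∃ (s : Finset ℕ) (v : ℕ → Plane),
      (∀ θ, ∑ i ∈ s, |(inner ℝ (v i) θ : ℝ)| ≤ supportFun K θ) ∧ L < 2 * ∑ i ∈ s, ‖v i‖ := by
  have hpi := Real.pi_pos
  have hne : K.Nonempty := hK.interior_nonempty.mono interior_subset
  obtain ⟨R, hR⟩ := hK.isCompact.isBounded.exists_norm_le
  have hR0 : 0 ≤ R := (norm_nonneg _).trans (hR _ hne.some_mem)
  have hlip : ∀ s t : ℝ, supportFun K (circ t) ≤ supportFun K (circ s) + R * |t - s| := by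
    intro s t
    have h1 := supportFun_sub_le hK.isCompact hne hR (circ t) (circ s)
    have h2 := mul_le_mul_of_nonneg_left (norm_circ_sub_circ_le t s) hR0
    linarith
  -- With `h = π / n`, the perimeter bound is `sinc (h / 2)` times a Riemann sum, whose error is at
  -- most `π R h` because the support function is `R`-Lipschitz.
  have hlim : Tendsto (fun n : ℕ => Real.sinc (Real.pi / n / 2) *
      (Real.pi / 2 * meanWidth K - Real.pi * (R * (Real.pi / n)))) atTop
      (𝓝 (Real.pi / 2 * meanWidth K)) := by
    have h0 : Tendsto (fun n : ℕ => Real.pi / (n : ℝ)) atTop (𝓝 0) :=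
      tendsto_const_div_atTop_nhds_zero_nat _
    have h1 : Tendsto (fun n : ℕ => Real.sinc (Real.pi / n / 2)) atTop (𝓝 1) := by
      have := (Real.continuous_sinc.tendsto 0).comp (by simpa using h0.div_const 2)
      rwa [Real.sinc_zero] at this
    have h2 := h1.mul (((h0.const_mul R).const_mul Real.pi).const_sub
      (Real.pi / 2 * meanWidth K))
    simpa using h2
  obtain ⟨n, hnL, hn2⟩ := ((hlim.eventually_const_lt hL).and (eventually_ge_atTop 2)).exists
  have hn0 : (0 : ℝ) < n := by exact_mod_cast (by omega : 0 < n)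
  set h := Real.pi / n with hh
  have hh0 : 0 < h := by positivity
  have hnh : n * h = Real.pi := by rw [hh]; field_simp
  choose q hqK hq using fun j : ℕ =>
    exists_inner_eq_supportFun hK.isCompact hne (circ (j * h))
  -- Support points need not be unique; taking `-q 0` as the last vertex makes the polygon close up
  -- symmetrically.
  set p : ℕ → Plane := fun j => if j < n then q j else -q 0 with hp
  have hp0 : p 0 = q 0 := if_pos (by omega)
  have hpn : p n = -p 0 := by rw [hp0]; exact if_neg (lt_irrefl n)
  have hpK : ∀ j ≤ n, p j ∈ K := by
    intro j _
    simp only [hp]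
    split_ifs
    · exact hqK j
    · exact neg_mem_of_isQuarterTurnBody hK (hqK 0)
  have hmax : ∀ j ≤ n, inner ℝ (p j) (circ (j * h)) = supportFun K (circ (j * h)) := by
    intro j hj
    rcases hj.lt_or_eq with hj | rfl
    · simp only [hp, if_pos hj]
      exact hq j
    · rw [hpn, hp0, hnh]
      have := hq 0
      rw [Nat.cast_zero, zero_mul] at this
      have e : circ Real.pi = -circ 0 := by rw [← circ_add_pi, zero_add]
      rw [e, inner_neg_neg, supportFun_neg hK, this]
  refine ⟨Finset.range n, fun j => (1 / 2 : ℝ) • (p (j + 1) - p j),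
    sum_abs_inner_edge_le hK hn2 hnh hpK hmax hpn, hnL.trans_le ?_⟩
  have hper := le_sum_norm_edge hnh hmax hpn
  have hint := integral_le_riemann_sum
    ((continuous_supportFun hK.isCompact hne).comp continuous_circ) hlip hR0 n hh0.le
  simp only [Function.comp_apply] at hint
  rw [hnh, integral_supportFun hK] at hint
  have hsum : 2 * ∑ j ∈ Finset.range n, ‖(1 / 2 : ℝ) • (p (j + 1) - p j)‖ =
      ∑ j ∈ Finset.range n, ‖p (j + 1) - p j‖ := by
    rw [Finset.mul_sum]
    refine Finset.sum_congr rfl fun j _ => ?_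
    rw [norm_smul, Real.norm_of_nonneg (by norm_num)]
    ring
  rw [hsum]
  refine le_trans ?_ hper
  have hsinc : Real.sinc (h / 2) = Real.sin (h / 2) / (h / 2) :=
    Real.sinc_of_ne_zero (by positivity)
  have hsin : 0 ≤ Real.sin (h / 2) :=
    Real.sin_nonneg_of_nonneg_of_le_pi (by positivity) (by
      have : h ≤ Real.pi := by
        rw [← hnh]
        exact le_mul_of_one_le_left hh0.le (by exact_mod_cast (by omega : 1 ≤ n))
      linarith)
  calc Real.sinc (h / 2) * (Real.pi / 2 * meanWidth K - Real.pi * (R * h))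
      ≤ Real.sinc (h / 2) * (h * ∑ j ∈ Finset.range n, supportFun K (circ (j * h))) := by
        refine mul_le_mul_of_nonneg_left (by linarith) ?_
        rw [hsinc]; positivity
    _ = _ := by rw [hsinc]; field_simp

/-! ### Merging parallel generators. -/

/-- The determinant of two plane vectors. -/
def cross (v w : Plane) : ℝ := v 0 * w 1 - v 1 * w 0

/-- By Lagrange's identity `⟨v, w⟩² + (cross v w)² = ‖v‖²‖w‖²`, so here Cauchy–Schwarz is an
equality. -/
theorem norm_add_or_norm_sub_of_cross_eq_zero {v w : Plane} (h : cross v w = 0) :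
    ‖v + w‖ = ‖v‖ + ‖w‖ ∨ ‖v - w‖ = ‖v‖ + ‖w‖ := by
  have hsq : (inner ℝ v w : ℝ) ^ 2 = (‖v‖ * ‖w‖) ^ 2 := by
    rw [mul_pow, norm_sq_coord, norm_sq_coord, inner_eq_coord]
    unfold cross at h
    linear_combination (-(v 0 * w 1 - v 1 * w 0)) * h
  have hv := norm_nonneg v
  have hw := norm_nonneg w
  rcases sq_eq_sq_iff_eq_or_eq_neg.1 hsq with e | e
  · left
    rw [← sq_eq_sq₀ (norm_nonneg _) (by positivity), norm_add_sq_real, e]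
    ring
  · right
    rw [← sq_eq_sq₀ (norm_nonneg _) (by positivity), norm_sub_sq_real, e]
    ring

/-- Parallel generators of a zonotope can be merged. -/
theorem exists_pairwise_cross_ne_zero (H : Plane → ℝ) (L : ℝ) (s : Finset ℕ) (v : ℕ → Plane)
    (hH : ∀ θ, ∑ i ∈ s, |(inner ℝ (v i) θ : ℝ)| ≤ H θ) (hL : L < 2 * ∑ i ∈ s, ‖v i‖) :
    ∃ (s : Finset ℕ) (v : ℕ → Plane), (∀ θ, ∑ i ∈ s, |(inner ℝ (v i) θ : ℝ)| ≤ H θ) ∧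
      L < 2 * ∑ i ∈ s, ‖v i‖ ∧ ∀ i ∈ s, ∀ j ∈ s, i ≠ j → cross (v i) (v j) ≠ 0 := by
  induction hc : s.card using Nat.strong_induction_on generalizing s v with
  | _ c ih =>
  by_cases hpw : ∀ i ∈ s, ∀ j ∈ s, i ≠ j → cross (v i) (v j) ≠ 0
  · exact ⟨s, v, hH, hL, hpw⟩
  push Not at hpw
  obtain ⟨i, hi, j, hj, hij, hcr⟩ := hpw
  -- Replacing the pair by `w` preserves total length and does not enlarge the zonotope, while the
  -- number of generators drops.
  obtain ⟨w, hw, hwn⟩ : ∃ w : Plane, (∀ θ, |(inner ℝ w θ : ℝ)| ≤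
      |(inner ℝ (v i) θ : ℝ)| + |(inner ℝ (v j) θ : ℝ)|) ∧ ‖w‖ = ‖v i‖ + ‖v j‖ := by
    rcases norm_add_or_norm_sub_of_cross_eq_zero hcr with h | h
    · exact ⟨_, fun θ => by rw [inner_add_left]; exact abs_add_le _ _, h⟩
    · exact ⟨_, fun θ => by rw [inner_sub_left]; exact abs_sub _ _, h⟩
  have hi' : i ∈ s.erase j := Finset.mem_erase.2 ⟨hij, hi⟩
  have hsum : ∀ F : Plane → ℝ, ∑ k ∈ s.erase j, F (Function.update v i w k) =
      ∑ k ∈ s, F (v k) - F (v i) - F (v j) + F w := by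
    intro F
    rw [← Finset.add_sum_erase _ _ hj, ← Finset.add_sum_erase _ _ hi',
      ← Finset.add_sum_erase _ _ hi', Function.update_self]
    have : ∑ k ∈ (s.erase j).erase i, F (Function.update v i w k) =
        ∑ k ∈ (s.erase j).erase i, F (v k) :=
      Finset.sum_congr rfl fun k hk => by
        rw [Function.update_of_ne (Finset.ne_of_mem_erase hk)]
    rw [this]
    ring
  refine ih _ ?_ (s.erase j) (Function.update v i w) (fun θ => ?_) ?_ rfl
  · rw [← hc]; exact Finset.card_erase_lt_of_mem hj
  · rw [hsum fun x => |(inner ℝ x θ : ℝ)|]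
    linarith [hw θ, hH θ]
  · rw [hsum fun x => ‖x‖, hwn]
    linarith

/-- The left side of `hv` is the support function of the zonotope, and a compact convex set is
determined by its support function. -/
theorem signed_sum_mem {K : Set Plane} (hK : IsCompact K) (hc : Convex ℝ K) (hne : K.Nonempty)
    {ι : Type*} [Fintype ι] (v : ι → Plane)
    (hv : ∀ θ, ∑ i, |(inner ℝ (v i) θ : ℝ)| ≤ supportFun K θ) (σ : ι → ℝ)
    (hσ : ∀ i, σ i = 1 ∨ σ i = -1) : ∑ i, σ i • v i ∈ K := by
  refine mem_of_inner_le_supportFun hK hc (fun θ => le_trans ?_ (hv θ)) hne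
  rw [sum_inner]
  refine Finset.sum_le_sum fun i _ => ?_
  rw [real_inner_smul_left]
  rcases hσ i with h | h <;> rw [h]
  · rw [one_mul]; exact le_abs_self _
  · rw [neg_one_mul]; exact neg_le_abs _

/-! ### The truncated zero set and its regularity. -/

section ZeroSet

variable {ι : Type*} {v : ι → Plane} {ε : ℝ}

/-- The zero lines of the `j`-th wave, away from the zeros of the other waves. -/
def zeroPiece (v : ι → Plane) (ε : ℝ) (j : ι) : Set Plane :=
  {x | Real.cos (2 * Real.pi * inner ℝ x (v j)) = 0} ∩
    ⋂ i ∈ {i : ι | i ≠ j}, {x | ε ≤ |Real.cos (2 * Real.pi * inner ℝ x (v i))|}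

theorem mem_zeroPiece {j : ι} {x : Plane} : x ∈ zeroPiece v ε j ↔
    Real.cos (2 * Real.pi * inner ℝ x (v j)) = 0 ∧
      ∀ i ≠ j, ε ≤ |Real.cos (2 * Real.pi * inner ℝ x (v i))| := by
  simp [zeroPiece]

theorem isClosed_zeroPiece (j : ι) : IsClosed (zeroPiece v ε j) :=
  (isClosed_eq (by fun_prop) continuous_const).inter
    (isClosed_biInter fun _ _ => isClosed_le continuous_const (by fun_prop))

theorem pairwise_disjoint_zeroPiece (hε : 0 < ε) :
    Pairwise (Function.onFun Disjoint (zeroPiece v ε)) := by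
  intro i j hij
  rw [Function.onFun, Set.disjoint_left]
  intro x hx hx'
  have := (mem_zeroPiece.1 hx').2 i hij
  rw [(mem_zeroPiece.1 hx).1, abs_zero] at this
  linarith

variable [Fintype ι]

/-- The zero set of a product of waves with neighbourhoods of the crossings removed. -/
def zeroSet (v : ι → Plane) (ε : ℝ) : Set Plane := ⋃ j, zeroPiece v ε j

theorem isClosed_zeroSet : IsClosed (zeroSet v ε) :=
  isClosed_iUnion_of_finite isClosed_zeroPiece

theorem zeroSet_subset : zeroSet v ε ⊆ {x | wave v x = 0} := by
  refine iUnion_subset fun j x hx => ?_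
  rw [mem_ofPred_eq, wave, Complex.ofReal_eq_zero]
  exact Finset.prod_eq_zero (Finset.mem_univ j) (mem_zeroPiece.1 hx).1

theorem eq_of_cos_eq_zero {a b : ℝ} (ha : Real.cos a = 0) (hb : Real.cos b = 0)
    (h : |a - b| < Real.pi) : a = b := by
  obtain ⟨k, rfl⟩ := Real.cos_eq_zero_iff.1 ha
  obtain ⟨l, rfl⟩ := Real.cos_eq_zero_iff.1 hb
  have e : (2 * (k : ℝ) + 1) * Real.pi / 2 - (2 * l + 1) * Real.pi / 2 =
      ((k - l : ℤ) : ℝ) * Real.pi := by push_cast; ring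
  rw [e, abs_mul, abs_of_pos Real.pi_pos] at h
  have h1 : |((k - l : ℤ) : ℝ)| < 1 := by
    by_contra! h2
    nlinarith [Real.pi_pos]
  have h2 : |k - l| < 1 := by exact_mod_cast h1
  rw [Int.abs_lt_one_iff, sub_eq_zero] at h2
  rw [h2]

/-- Below a fixed scale a ball meets at most one zero line, and a line meets a ball of radius `r` in
length at most `2r`; hence the sharp constant `φ(0) = 1`. -/
theorem exists_radius_hausdorffOne_le (v : ι → Plane) (hε : 0 < ε) :
    ∃ r₀ ∈ Ioo (0 : ℝ) 1, ∀ x r, 0 < r → r < r₀ →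
      hausdorffOne (zeroSet v ε ∩ Metric.ball x r) ≤ ENNReal.ofReal (2 * r) := by
  set M : ℝ := ∑ i, ‖v i‖ + 1 with hM
  have hM0 : 0 < M := by positivity
  have hvM : ∀ i, ‖v i‖ ≤ M := fun i => by
    have := Finset.single_le_sum (f := fun i => ‖v i‖) (fun i _ => norm_nonneg _)
      (Finset.mem_univ i)
    linarith
  have hpi := Real.pi_pos
  have hpi3 := Real.pi_gt_three
  set η := min ε 1 with hη
  have hη0 : 0 < η := lt_min hε one_pos
  have hηε : η ≤ ε := min_le_left _ _
  have hη1 : η ≤ 1 := min_le_right _ _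
  -- Two points of the ball are less than `2r` apart, so each phase varies by less than `η`. The
  -- bound `η ≤ ε` excludes a second wave, and `η ≤ 1 < π` excludes a second line of the same wave.
  refine ⟨min (1 / 2) (η / (4 * Real.pi * M)), ⟨by positivity, ?_⟩, fun x r hr hr₀ => ?_⟩
  · exact (min_le_left _ _).trans_lt (by norm_num)
  have hrη : 4 * Real.pi * M * r < η := by
    have := hr₀.trans_le (min_le_right _ _)
    rw [lt_div_iff₀ (by positivity)] at this
    linarith
  rcases (zeroSet v ε ∩ Metric.ball x r).eq_empty_or_nonempty with h | ⟨y, hy, hyx⟩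
  · rw [h, measure_empty]
    exact zero_le
  obtain ⟨j, hj⟩ := mem_iUnion.1 hy
  rw [mem_zeroPiece] at hj
  have hvj : v j ≠ 0 := by
    intro h0
    have := hj.1
    rw [h0, inner_zero_right, mul_zero, Real.cos_zero] at this
    exact one_ne_zero this
  refine le_trans (measure_mono ?_) (hausdorffOne_line_inter_ball_le hvj x hr (inner ℝ y (v j)))
  rintro z ⟨hz, hzx⟩
  refine ⟨?_, hzx⟩
  have hzy : dist z y < 2 * r := by
    have h1 := Metric.mem_ball.1 hzx
    have h2 := Metric.mem_ball.1 hyx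
    have := dist_triangle_right z y x
    linarith
  have hdiff : ∀ i, |2 * Real.pi * inner ℝ z (v i) - 2 * Real.pi * inner ℝ y (v i)| < η := by
    intro i
    rw [← mul_sub, ← inner_sub_left, abs_mul, abs_of_pos (by positivity)]
    refine lt_of_le_of_lt ?_ hrη
    have h1 : |(inner ℝ (z - y) (v i) : ℝ)| ≤ 2 * r * M := by
      refine (abs_real_inner_le_norm _ _).trans ?_
      rw [← dist_eq_norm]
      exact mul_le_mul hzy.le (hvM i) (norm_nonneg _) (by positivity)
    calc 2 * Real.pi * |(inner ℝ (z - y) (v i) : ℝ)| ≤ 2 * Real.pi * (2 * r * M) :=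
          mul_le_mul_of_nonneg_left h1 (by positivity)
      _ = 4 * Real.pi * M * r := by ring
  obtain ⟨i, hi⟩ := mem_iUnion.1 hz
  rw [mem_zeroPiece] at hi
  by_cases hij : i = j
  · subst hij
    have := eq_of_cos_eq_zero hi.1 hj.1 ((hdiff i).trans (by linarith))
    exact mul_left_cancel₀ (by positivity) this
  · exfalso
    have h1 := hj.2 i hij
    have h2 := Real.abs_cos_sub_cos_le (2 * Real.pi * inner ℝ y (v i))
      (2 * Real.pi * inner ℝ z (v i))
    rw [hi.1, sub_zero, abs_sub_comm] at h2
    linarith [hdiff i]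

theorem exists_isRegularSet_zeroSet (v : ι → Plane) (hε : 0 < ε) :
    ∃ φ : ℝ → ℝ≥0, φ 0 = 1 ∧ IsRegularSet φ (zeroSet v ε) := by
  obtain ⟨r₀, ⟨hr₀, hr₁⟩, hr⟩ := exists_radius_hausdorffOne_le v hε
  obtain ⟨t, -, ht⟩ := (isCompact_closedBall (0 : Plane) 1).elim_finite_subcover_image
    (b := univ) (c := fun y => Metric.ball y (r₀ / 2)) (fun _ _ => Metric.isOpen_ball)
    (fun y _ => mem_iUnion₂.2 ⟨y, mem_univ y, Metric.mem_ball_self (by positivity)⟩)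
  obtain ⟨htf, htc⟩ := ht
  -- For `r ≥ r₀` it is enough to count the balls of radius `r₀ / 2` that cover a unit ball.
  refine ⟨fun r => if r < r₀ then 1 else htf.toFinset.card, if_pos hr₀, ?_, isClosed_zeroSet, ?_⟩
  · have : (fun r : ℝ => if r < r₀ then (1 : ℝ≥0) else htf.toFinset.card) =ᶠ[𝓝 0]
        fun _ => 1 := by
      filter_upwards [Iio_mem_nhds hr₀] with r h
      exact if_pos h
    exact (continuousAt_const.congr this.symm).continuousWithinAt
  · rintro x r ⟨h0, h1⟩
    by_cases h : r < r₀
    · simpa [h] using hr x r h0 h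
    · simp only [h, if_false]
      have hsub : zeroSet v ε ∩ Metric.ball x r ⊆
          ⋃ y ∈ htf.toFinset, zeroSet v ε ∩ Metric.ball (x + y) (r₀ / 2) := by
        rintro z ⟨hz, hzx⟩
        have hz1 : z - x ∈ Metric.closedBall (0 : Plane) 1 := by
          rw [mem_closedBall_zero_iff, ← dist_eq_norm]
          linarith [Metric.mem_ball.1 hzx]
        obtain ⟨y, hy, hzy⟩ := mem_iUnion₂.1 (htc hz1)
        refine mem_iUnion₂.2 ⟨y, htf.mem_toFinset.2 hy, hz, ?_⟩
        rw [Metric.mem_ball, dist_eq_norm] at hzy ⊢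
        rwa [← sub_sub]
      refine (measure_mono hsub).trans ((measure_biUnion_finset_le _ _).trans ?_)
      refine (Finset.sum_le_sum fun y _ =>
        hr (x + y) (r₀ / 2) (by positivity) (by linarith)).trans ?_
      rw [Finset.sum_const, nsmul_eq_mul]
      push_cast
      gcongr
      linarith

end ZeroSet

/-! ### Lower density of the truncated zero set. -/

/-- Jordan's inequality for the sine, shifted to the zeros `1 / 2 + ℤ` of `cos (π y)`. -/
theorem two_mul_abs_sub_round_le (y : ℝ) :
    2 * |y - 1 / 2 - round (y - 1 / 2)| ≤ |Real.cos (Real.pi * y)| := by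
  set k := round (y - 1 / 2) with hk
  set z := y - 1 / 2 - k with hz
  have hz2 : |z| ≤ 1 / 2 := abs_sub_round _
  have hpi := Real.pi_pos
  have h := Real.mul_abs_le_abs_sin (x := Real.pi * z) (by
    rw [abs_mul, abs_of_pos hpi]
    nlinarith)
  have e : Real.cos (Real.pi * y) = (-1) ^ k * -Real.sin (Real.pi * z) := by
    rw [← Real.cos_add_pi_div_two, ← Real.cos_add_int_mul_pi]
    congr 1
    rw [hz]
    ring
  rw [e, abs_mul, abs_zpow, abs_neg, abs_one, one_zpow, one_mul, abs_neg]
  refine le_trans (le_of_eq ?_) h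
  rw [abs_mul, abs_of_pos hpi]
  field_simp

/-- On unit intervals, a cosine is rarely small. -/
theorem exists_volume_abs_cos_lt_le {γ : ℝ} (hγ : γ ≠ 0) : ∃ C : ℝ, 0 ≤ C ∧
    ∀ ε b c : ℝ, 0 ≤ ε → volume {t ∈ Ico b (b + 1) | |Real.cos (c + γ * t)| < ε} ≤
      ENNReal.ofReal (C * ε) := by
  have hpi := Real.pi_pos
  have hγ0 : 0 < |γ| := abs_pos.2 hγ
  set M : ℤ := ⌈|γ| / Real.pi⌉ + 1 with hM
  have hM0 : 0 ≤ M := by positivity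
  -- At most `2M + 1` zeros matter on a unit interval, each with a neighbourhood of length `επ /
  -- |γ|`. The constant does not depend on the phase `c`.
  refine ⟨(2 * M + 1) * (Real.pi / |γ|), by positivity, fun ε b c hε => ?_⟩
  set k₀ : ℤ := round ((c + γ * b) / Real.pi - 1 / 2) with hk₀
  have hsub : {t ∈ Ico b (b + 1) | |Real.cos (c + γ * t)| < ε} ⊆
      ⋃ k ∈ Finset.Icc (k₀ - M) (k₀ + M),
        Metric.closedBall ((Real.pi * (k + 1 / 2) - c) / γ) (ε * Real.pi / (2 * |γ|)) := by
    rintro t ⟨⟨htb, htb'⟩, ht⟩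
    set y := (c + γ * t) / Real.pi with hy
    have hyt : Real.pi * y = c + γ * t := by rw [hy]; field_simp
    have h := two_mul_abs_sub_round_le y
    rw [hyt] at h
    refine mem_iUnion₂.2 ⟨round (y - 1 / 2), ?_, ?_⟩
    · have h1 := abs_sub_round (y - 1 / 2)
      have h2 := abs_sub_round ((c + γ * b) / Real.pi - 1 / 2)
      rw [← hk₀] at h2
      have h3 : |y - (c + γ * b) / Real.pi| ≤ |γ| / Real.pi := by
        rw [hy, ← sub_div, abs_div, abs_of_pos hpi]
        refine div_le_div_of_nonneg_right ?_ hpi.le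
        rw [add_sub_add_left_eq_sub, ← mul_sub, abs_mul, abs_of_nonneg (by linarith : 0 ≤ t - b)]
        exact mul_le_of_le_one_right hγ0.le (by linarith)
      have h4 : |γ| / Real.pi ≤ ⌈|γ| / Real.pi⌉ := Int.le_ceil _
      have h5 : (M : ℝ) = ⌈|γ| / Real.pi⌉ + 1 := by rw [hM]; push_cast; ring
      rw [abs_le] at h1 h2 h3
      rw [Finset.mem_Icc]
      constructor
      · have : ((k₀ - M : ℤ) : ℝ) ≤ round (y - 1 / 2) := by push_cast; linarith
        exact_mod_cast this
      · have : ((round (y - 1 / 2) : ℤ) : ℝ) ≤ ((k₀ + M : ℤ) : ℝ) := by push_cast; linarith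
        exact_mod_cast this
    · rw [Metric.mem_closedBall, Real.dist_eq]
      have e : t - (Real.pi * ((round (y - 1 / 2) : ℤ) + 1 / 2) - c) / γ =
          Real.pi / γ * (y - 1 / 2 - round (y - 1 / 2)) := by
        have : t = (Real.pi * y - c) / γ := by rw [hyt]; field_simp; ring
        rw [this]
        field_simp
        ring
      rw [e, abs_mul, abs_div, abs_of_pos hpi]
      calc Real.pi / |γ| * |y - 1 / 2 - round (y - 1 / 2)| ≤ Real.pi / |γ| * (ε / 2) := by
            gcongr
            linarith
        _ = ε * Real.pi / (2 * |γ|) := by field_simp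
  refine (measure_mono hsub).trans ((measure_biUnion_finset_le _ _).trans ?_)
  simp_rw [Real.volume_closedBall]
  rw [Finset.sum_const, Int.card_Icc, nsmul_eq_mul, ← ENNReal.ofReal_natCast,
    ← ENNReal.ofReal_mul (by positivity)]
  refine ENNReal.ofReal_le_ofReal (le_of_eq ?_)
  have : (((k₀ + M + 1 - (k₀ - M)).toNat : ℕ) : ℝ) = 2 * M + 1 := by
    rw [show k₀ + M + 1 - (k₀ - M) = 2 * M + 1 by ring]
    have := congrArg (Int.cast : ℤ → ℝ) (Int.toNat_of_nonneg (by positivity : 0 ≤ 2 * M + 1))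
    rw [Int.cast_natCast] at this
    rw [this]
    push_cast
    ring
  rw [this]
  field_simp

/-- A measure giving mass at least `c` to all translates of `Q` gives mass at least proportional
to the area to all large balls. -/
theorem mul_volume_ball_le (μ : Measure Plane) [SFinite μ] {Q : Set Plane} (hQ : MeasurableSet Q)
    {ρ : ℝ} (hρ : ∀ z ∈ Q, ‖z‖ ≤ ρ) {c : ℝ≥0∞} (hc : ∀ y, c ≤ μ {z | z - y ∈ Q})
    (x : Plane) (r : ℝ) :
    c * volume (Metric.ball x (r - ρ)) ≤ volume Q * μ (Metric.ball x r) := by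
  set ν := (volume : Measure Plane).restrict (Metric.ball x (r - ρ)) with hν
  have hS : MeasurableSet {q : Plane × Plane | q.2 - q.1 ∈ Q} :=
    (measurable_snd.sub measurable_fst) hQ
  -- Double counting: the mass of `y + Q` is integrated over `y` in the smaller ball, then the order
  -- of integration is exchanged.
  calc c * volume (Metric.ball x (r - ρ)) = ∫⁻ _, c ∂ν := by
        rw [lintegral_const, hν, Measure.restrict_apply_univ]
    _ ≤ ∫⁻ y, μ {z | z - y ∈ Q} ∂ν := lintegral_mono hc
    _ = (ν.prod μ) {q : Plane × Plane | q.2 - q.1 ∈ Q} := (Measure.prod_apply hS).symm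
    _ = ∫⁻ z, ν {y | z - y ∈ Q} ∂μ := Measure.prod_apply_symm hS
    _ ≤ ∫⁻ z, (Metric.ball x r).indicator (fun _ => volume Q) z ∂μ := by
        refine lintegral_mono fun z => ?_
        have hm : MeasurableSet {y : Plane | z - y ∈ Q} := (measurable_const.sub measurable_id) hQ
        by_cases hz : z ∈ Metric.ball x r
        · rw [indicator_of_mem hz]
          refine (Measure.restrict_le_self _).trans_eq ?_
          exact (Measure.measurePreserving_sub_left volume z).measure_preimage
            hQ.nullMeasurableSet
        · rw [indicator_of_notMem hz, hν, Measure.restrict_apply hm]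
          refine (measure_mono_null (t := ∅) ?_ measure_empty).le
          rintro y ⟨hy, hyx⟩
          refine hz ?_
          have h1 := hρ _ hy
          rw [← dist_eq_norm] at h1
          rw [Metric.mem_ball] at hyx ⊢
          linarith [dist_triangle z y x]
    _ = volume Q * μ (Metric.ball x r) := by
        rw [lintegral_indicator measurableSet_ball, setLIntegral_const]

/-- A rectangle with sides along `v` and orthogonal to `v`. -/
def stripCell (v : Plane) : Set Plane :=
  {z | (inner ℝ z v : ℝ) ∈ Ico (0 : ℝ) (1 / 2) ∧ (inner ℝ z (lineDir v) : ℝ) ∈ Ico (0 : ℝ) 1}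

theorem measurableSet_stripCell (v : Plane) : MeasurableSet (stripCell v) := by
  have h1 : Continuous fun z : Plane => (inner ℝ z v : ℝ) := by fun_prop
  have h2 : Continuous fun z : Plane => (inner ℝ z (lineDir v) : ℝ) := by fun_prop
  exact (h1.measurable measurableSet_Ico).inter (h2.measurable measurableSet_Ico)

theorem norm_le_of_mem_stripCell {v : Plane} (hv : v ≠ 0) {z : Plane} (hz : z ∈ stripCell v) :
    ‖z‖ ≤ 1 / 2 * ‖v‖⁻¹ + 1 := by
  obtain ⟨⟨h1, h2⟩, h3, h4⟩ := hz
  have hv0 : 0 < ‖v‖ := norm_pos_iff.2 hv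
  rw [eq_smul_add_smul_lineDir hv z]
  refine (norm_add_le _ _).trans (add_le_add ?_ ?_)
  · rw [norm_smul, norm_mul, Real.norm_of_nonneg h1, Real.norm_of_nonneg (by positivity)]
    have : (inner ℝ z v : ℝ) * (‖v‖ ^ 2)⁻¹ * ‖v‖ = inner ℝ z v * ‖v‖⁻¹ := by field_simp
    rw [this]
    gcongr
  · rw [norm_smul, norm_lineDir hv, mul_one, Real.norm_of_nonneg h3]
    exact h4.le

/-- The coordinates `⟨z, v⟩` and `⟨z, lineDir v⟩` have Jacobian `‖v‖`. -/
theorem volume_stripCell {v : Plane} (hv : v ≠ 0) :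
    volume (stripCell v) = ENNReal.ofReal (2 * ‖v‖)⁻¹ := by
  have hv0 : 0 < ‖v‖ := norm_pos_iff.2 hv
  set A : Matrix (Fin 2) (Fin 2) ℝ := !![v 0, v 1; lineDir v 0, lineDir v 1] with hA
  have hdet : LinearMap.det (Matrix.toLin' A) = ‖v‖ := by
    rw [LinearMap.det_toLin', hA, Matrix.det_fin_two_of]
    simp only [lineDir, quarterTurn, PiLp.smul_apply, smul_eq_mul, Matrix.cons_val_zero,
      Matrix.cons_val_one]
    have := norm_sq_coord v
    field_simp
    linarith
  set box : Set (Fin 2 → ℝ) := univ.pi fun i => Ico ((![0, 0] : Fin 2 → ℝ) i)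
    ((![1 / 2, 1] : Fin 2 → ℝ) i) with hbox
  have hpre : stripCell v = WithLp.ofLp ⁻¹' (Matrix.toLin' A ⁻¹' box) := by
    ext z
    simp only [stripCell, inner_eq_coord, hbox, hA, mem_preimage, Set.mem_pi, mem_univ, true_imp_iff,
      Fin.forall_fin_two, Matrix.toLin'_apply, Matrix.mulVec, dotProduct, Fin.sum_univ_two,
      mem_ofPred_eq, mem_Ico]
    simp [mul_comm (z.ofLp _)]
  have hboxm : MeasurableSet box := MeasurableSet.univ_pi fun _ => measurableSet_Ico
  rw [hpre, (PiLp.volume_preserving_ofLp (Fin 2)).measure_preimage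
    ((LinearMap.continuous_of_finiteDimensional _).measurable hboxm).nullMeasurableSet,
    Measure.addHaar_preimage_linearMap _ (by rw [hdet]; exact hv0.ne'), hdet, hbox,
    Real.volume_pi_Ico, Fin.prod_univ_two, ← ENNReal.ofReal_mul (by simp),
    ← ENNReal.ofReal_mul (by positivity), abs_of_pos (by positivity)]
  congr 1
  simp [mul_comm]

section Density

variable {ι : Type*} [Fintype ι] {v : ι → Plane} {ε : ℝ}

/-- Supplies the s-finiteness that Tonelli's theorem requires in `mul_volume_ball_le`. -/
theorem isLocallyFiniteMeasure_zeroPiece (hε : 0 < ε) (j : ι) :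
    IsLocallyFiniteMeasure (hausdorffOne.restrict (zeroPiece v ε j)) := by
  obtain ⟨r₀, ⟨hr₀, -⟩, hr⟩ := exists_radius_hausdorffOne_le v hε
  refine ⟨fun x => ⟨Metric.ball x (r₀ / 2), Metric.ball_mem_nhds x (by positivity), ?_⟩⟩
  rw [Measure.restrict_apply measurableSet_ball, inter_comm]
  refine lt_of_le_of_lt (measure_mono (inter_subset_inter_left _ (subset_iUnion _ j))) ?_
  exact (hr x (r₀ / 2) (by positivity) (by linarith)).trans_lt ENNReal.ofReal_lt_top

theorem inner_lineDir_eq_cross (v w : Plane) :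
    (inner ℝ (lineDir v) w : ℝ) = ‖v‖⁻¹ * cross v w := by
  simp [inner_eq_coord, lineDir, quarterTurn, cross]
  ring

/-- Each cell contains a segment of length `1` of the zero lines, most of which is kept. -/
theorem exists_le_hausdorffOne_cell {j : ι} (hvj : v j ≠ 0)
    (hcr : ∀ i ≠ j, cross (v j) (v i) ≠ 0) : ∃ C : ℝ, 0 ≤ C ∧ ∀ ε, 0 ≤ ε → ∀ y,
      ENNReal.ofReal (1 - C * ε) ≤
        hausdorffOne.restrict (zeroPiece v ε j) {z | z - y ∈ stripCell (v j)} := by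
  classical
  have hpi := Real.pi_pos
  have hn : 0 < ‖v j‖ := norm_pos_iff.2 hvj
  set u := lineDir (v j) with hu
  have hγ : ∀ i, i ≠ j → 2 * Real.pi * (inner ℝ u (v i) : ℝ) ≠ 0 := fun i hi => by
    rw [hu, inner_lineDir_eq_cross]
    exact mul_ne_zero (by positivity) (mul_ne_zero (by positivity) (hcr i hi))
  choose! C hC0 hC using fun i hi => exists_volume_abs_cos_lt_le (hγ i hi)
  refine ⟨∑ i ∈ Finset.univ.erase j, C i,
    Finset.sum_nonneg fun i hi => hC0 i (Finset.ne_of_mem_erase hi), fun ε hε y => ?_⟩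
  set b : ℝ := inner ℝ y u with hb
  -- The zeros of `cos (2π s)` are `1 / 4 + k / 2`, so exactly one lies in the half-open range of
  -- length `1 / 2` swept by the cell at `y`.
  set k : ℤ := ⌈2 * ((inner ℝ y (v j) : ℝ) - 1 / 4)⌉ with hk
  set s : ℝ := 1 / 4 + k / 2 with hs
  have hs1 : (inner ℝ y (v j) : ℝ) ≤ s := by
    have := Int.le_ceil (2 * ((inner ℝ y (v j) : ℝ) - 1 / 4))
    rw [hs]; linarith
  have hs2 : s < (inner ℝ y (v j) : ℝ) + 1 / 2 := by
    have := Int.ceil_lt_add_one (2 * ((inner ℝ y (v j) : ℝ) - 1 / 4))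
    rw [hs]; linarith
  have hscos : Real.cos (2 * Real.pi * s) = 0 :=
    Real.cos_eq_zero_iff.2 ⟨k, by rw [hs]; ring⟩
  set P : Plane := (s * (‖v j‖ ^ 2)⁻¹) • v j with hP
  have hPv : (inner ℝ P (v j) : ℝ) = s := by
    rw [hP, real_inner_smul_left, real_inner_self_eq_norm_sq]
    field_simp
  have hPu : (inner ℝ P u : ℝ) = 0 := by
    rw [hP, real_inner_smul_left, real_inner_comm, hu, inner_lineDir_self, mul_zero]
  have huu : (inner ℝ u u : ℝ) = 1 := by
    rw [real_inner_self_eq_norm_sq, hu, norm_lineDir hvj, one_pow]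
  have huv : (inner ℝ u (v j) : ℝ) = 0 := inner_lineDir_self _
  set bad : ι → Set ℝ := fun i => {t ∈ Ico b (b + 1) |
    |Real.cos (2 * Real.pi * inner ℝ P (v i) + 2 * Real.pi * (inner ℝ u (v i) : ℝ) * t)| < ε}
    with hbad
  -- Parameters of the points kept by the truncation. Along the line every other wave oscillates at
  -- a nonzero rate, so the loss is at most `C ε`, uniformly in `y`.
  set A : Set ℝ := Ico b (b + 1) \ ⋃ i ∈ Finset.univ.erase j, bad i with hA
  have hsub : (fun t : ℝ => P + t • u) '' A ⊆
      {z | z - y ∈ stripCell (v j)} ∩ zeroPiece v ε j := by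
    rintro _ ⟨t, ⟨ht, htbad⟩, rfl⟩
    have hv : (inner ℝ (P + t • u) (v j) : ℝ) = s := by
      rw [inner_add_left, real_inner_smul_left u, hPv, huv, mul_zero, add_zero]
    have hu' : (inner ℝ (P + t • u) u : ℝ) = t := by
      rw [inner_add_left, real_inner_smul_left u, hPu, huu, mul_one, zero_add]
    refine ⟨⟨?_, ?_⟩, mem_zeroPiece.2 ⟨?_, fun i hi => ?_⟩⟩
    · rw [inner_sub_left, hv]
      constructor <;> linarith
    · rw [inner_sub_left, ← hu, hu', ← hb]
      constructor <;> linarith [ht.1, ht.2]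
    · simp only
      rw [hv, hscos]
    · by_contra! hlt
      refine htbad (mem_iUnion₂.2 ⟨i, Finset.mem_erase.2 ⟨hi, Finset.mem_univ i⟩, ht, ?_⟩)
      refine lt_of_eq_of_lt ?_ hlt
      rw [inner_add_left, real_inner_smul_left u]
      congr 2
      ring
  have hmeas : MeasurableSet {z : Plane | z - y ∈ stripCell (v j)} :=
    (measurable_id.sub measurable_const) (measurableSet_stripCell _)
  rw [Measure.restrict_apply hmeas]
  refine le_trans ?_ ((volume_le_hausdorffOne_line P u (norm_lineDir hvj) A).trans
    (measure_mono hsub))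
  have hbadsum : volume (⋃ i ∈ Finset.univ.erase j, bad i) ≤
      ENNReal.ofReal ((∑ i ∈ Finset.univ.erase j, C i) * ε) := by
    refine (measure_biUnion_finset_le _ _).trans ?_
    rw [Finset.sum_mul, ENNReal.ofReal_sum_of_nonneg fun i hi =>
      mul_nonneg (hC0 i (Finset.ne_of_mem_erase hi)) hε]
    exact Finset.sum_le_sum fun i hi => hC i (Finset.ne_of_mem_erase hi) ε b _ hε
  have hvol : volume (Ico b (b + 1)) = ENNReal.ofReal 1 := by
    rw [Real.volume_Ico, add_sub_cancel_left]
  refine le_trans ?_ le_measure_sdiff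
  rw [hvol, ENNReal.ofReal_sub _ (mul_nonneg (Finset.sum_nonneg fun i hi =>
    hC0 i (Finset.ne_of_mem_erase hi)) hε)]
  exact tsub_le_tsub_left hbadsum _

/-- Length about `1` in every cell of area `1 / (2‖v j‖)`. -/
theorem exists_le_hausdorffOne_zeroPiece {j : ι} (hcr : ∀ i ≠ j, cross (v j) (v i) ≠ 0) :
    ∃ C ρ : ℝ, 0 ≤ C ∧ 0 ≤ ρ ∧ ∀ ε, 0 < ε → ∀ x r,
      ENNReal.ofReal (2 * ‖v j‖ * (1 - C * ε)) * volume (Metric.ball x (r - ρ)) ≤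
        hausdorffOne (zeroPiece v ε j ∩ Metric.ball x r) := by
  rcases eq_or_ne (v j) 0 with h0 | hvj
  · exact ⟨0, 0, le_rfl, le_rfl, fun ε _ x r => by simp [h0]⟩
  have hn : 0 < ‖v j‖ := norm_pos_iff.2 hvj
  obtain ⟨C, hC0, hC⟩ := exists_le_hausdorffOne_cell hvj hcr
  refine ⟨C, 1 / 2 * ‖v j‖⁻¹ + 1, hC0, by positivity, fun ε hε x r => ?_⟩
  have := isLocallyFiniteMeasure_zeroPiece (v := v) hε j
  have h := mul_volume_ball_le (hausdorffOne.restrict (zeroPiece v ε j))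
    (measurableSet_stripCell (v j)) (fun z hz => norm_le_of_mem_stripCell hvj hz)
    (hC ε hε.le) x r
  rw [volume_stripCell hvj, Measure.restrict_apply measurableSet_ball] at h
  rw [inter_comm]
  calc ENNReal.ofReal (2 * ‖v j‖ * (1 - C * ε)) *
        volume (Metric.ball x (r - (1 / 2 * ‖v j‖⁻¹ + 1)))
      = ENNReal.ofReal (2 * ‖v j‖) * (ENNReal.ofReal (1 - C * ε) *
        volume (Metric.ball x (r - (1 / 2 * ‖v j‖⁻¹ + 1)))) := by
        rw [ENNReal.ofReal_mul (by positivity), mul_assoc]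
    _ ≤ ENNReal.ofReal (2 * ‖v j‖) * (ENNReal.ofReal (2 * ‖v j‖)⁻¹ *
        hausdorffOne (Metric.ball x r ∩ zeroPiece v ε j)) := by gcongr
    _ = hausdorffOne (Metric.ball x r ∩ zeroPiece v ε j) := by
        rw [← mul_assoc, ← ENNReal.ofReal_mul (by positivity),
          mul_inv_cancel₀ (by positivity), ENNReal.ofReal_one, one_mul]

theorem exists_le_hausdorffOne_zeroSet (hcr : ∀ i j, i ≠ j → cross (v i) (v j) ≠ 0) :
    ∃ C ρ : ℝ, 0 ≤ ρ ∧ ∀ ε, 0 < ε → ∀ x r,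
      ENNReal.ofReal (2 * (∑ j, ‖v j‖) * (1 - C * ε)) * volume (Metric.ball x (r - ρ)) ≤
        hausdorffOne (zeroSet v ε ∩ Metric.ball x r) := by
  choose C ρ hC0 hρ0 h using fun j =>
    exists_le_hausdorffOne_zeroPiece (v := v) (j := j) fun i hi => hcr j i hi.symm
  refine ⟨∑ j, C j, ∑ j, ρ j, Finset.sum_nonneg fun j _ => hρ0 j, fun ε hε x r => ?_⟩
  have hCj : ∀ j, C j ≤ ∑ j, C j := fun j =>
    Finset.single_le_sum (fun i _ => hC0 i) (Finset.mem_univ j)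
  have hρj : ∀ j, ρ j ≤ ∑ j, ρ j := fun j =>
    Finset.single_le_sum (fun i _ => hρ0 i) (Finset.mem_univ j)
  have hunion : hausdorffOne (zeroSet v ε ∩ Metric.ball x r) =
      ∑ j, hausdorffOne (zeroPiece v ε j ∩ Metric.ball x r) := by
    rw [zeroSet, iUnion_inter, measure_iUnion, tsum_fintype]
    · exact fun i j hij => (pairwise_disjoint_zeroPiece hε hij).mono inter_subset_left
        inter_subset_left
    · exact fun j => (isClosed_zeroPiece j).measurableSet.inter measurableSet_ball
  rw [hunion]
  calc _ ≤ (∑ j, ENNReal.ofReal (2 * ‖v j‖ * (1 - (∑ j, C j) * ε))) *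
        volume (Metric.ball x (r - ∑ j, ρ j)) := by
        gcongr
        -- The summands may be negative when `ε` is large, but `ENNReal.ofReal` is subadditive
        -- regardless of sign.
        rw [Finset.mul_sum, Finset.sum_mul]
        exact Finset.le_sum_of_subadditive ENNReal.ofReal ENNReal.ofReal_zero.le
          (fun _ _ => ENNReal.ofReal_add_le) _ _
    _ ≤ _ := by
        rw [Finset.sum_mul]
        refine Finset.sum_le_sum fun j _ => le_trans ?_ (h j ε hε x r)
        gcongr
        · exact hCj j
        · exact hρj j

/-- Shrinking the radius by a fixed `ρ` changes the area by the factor `(1 - ρ / r)²`, which tends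
to `1`. -/
theorem ofReal_le_lowerDensity {Γ : Set Plane} {D ρ : ℝ} (hρ : 0 ≤ ρ)
    (h : ∀ x r, ENNReal.ofReal D * volume (Metric.ball x (r - ρ)) ≤
      hausdorffOne (Γ ∩ Metric.ball x r)) : ENNReal.ofReal D ≤ lowerDensity Γ := by
  have hlim : Tendsto (fun r : ℝ => ENNReal.ofReal D * ENNReal.ofReal ((1 - ρ / r) ^ 2)) atTop
      (𝓝 (ENNReal.ofReal D)) := by
    have h1 : Tendsto (fun r : ℝ => (1 - ρ / r) ^ 2) atTop (𝓝 ((1 - 0) ^ 2)) :=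
      ((tendsto_const_nhds.div_atTop tendsto_id).const_sub 1).pow 2
    have h2 := ENNReal.Tendsto.const_mul (ENNReal.tendsto_ofReal h1)
      (Or.inr (ENNReal.ofReal_ne_top (r := D)))
    simpa using h2
  rw [lowerDensity, ← hlim.liminf_eq]
  refine liminf_le_liminf ?_
  filter_upwards [eventually_gt_atTop ρ] with r hr
  have hr0 : 0 < r := hρ.trans_lt hr
  refine le_iInf fun x => ?_
  have hvol : volume (Metric.ball x r) ≠ 0 := (Metric.measure_ball_pos volume x hr0).ne'
  rw [ENNReal.le_div_iff_mul_le (Or.inl hvol) (Or.inl measure_ball_lt_top.ne)]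
  refine le_trans (le_of_eq ?_) (h x r)
  rw [mul_assoc]
  congr 1
  rw [Measure.addHaar_ball _ x hr0.le, Measure.addHaar_ball _ x (by linarith : 0 ≤ r - ρ),
    ← mul_assoc, ← ENNReal.ofReal_mul (by positivity), finrank_euclideanSpace_fin]
  congr 2
  field_simp

theorem exists_lt_lowerDensity_zeroSet (hcr : ∀ i j, i ≠ j → cross (v i) (v j) ≠ 0) {L : ℝ}
    (hL : L < 2 * ∑ j, ‖v j‖) : ∃ ε, 0 < ε ∧ (L : EReal) < (lowerDensity (zeroSet v ε) : EReal) := by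
  obtain ⟨C, ρ, hρ, h⟩ := exists_le_hausdorffOne_zeroSet hcr
  have hlim : Tendsto (fun ε : ℝ => 2 * (∑ j, ‖v j‖) * (1 - C * ε)) (𝓝[>] 0)
      (𝓝 (2 * (∑ j, ‖v j‖) * (1 - C * 0))) :=
    (Continuous.tendsto (by fun_prop) 0).mono_left nhdsWithin_le_nhds
  rw [mul_zero, sub_zero, mul_one] at hlim
  obtain ⟨ε, hεL, hε⟩ := ((hlim.eventually_const_lt hL).and self_mem_nhdsWithin).exists
  refine ⟨ε, hε, lt_of_lt_of_le ?_
    (EReal.coe_ennreal_le_coe_ennreal_iff.2 (ofReal_le_lowerDensity hρ (h ε hε)))⟩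
  rw [EReal.coe_ennreal_ofReal, EReal.coe_lt_coe_iff]
  exact hεL.trans_le (le_max_left _ _)

end Density

/-! ### Assembly: sharpness of the constant and the examples. -/

/-- There are functions with spectrum in `K` which vanish on a regular set of nearly critical
density. -/
theorem exists_wave_vanishing {K : Set Plane} (hK : IsQuarterTurnBody K) {δ : ℝ} (hδ : 0 < δ) :
    ∃ f ∈ PaleyWiener ∞ K, ∃ (φ : ℝ → ℝ≥0) (Γ : Set Plane),
      f 0 = 1 ∧ eLpNorm f ∞ volume = 1 ∧ IsRegularSet φ Γ ∧ φ 0 = 1 ∧ Γ ⊆ {x | f x = 0} ∧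
        (((Real.pi / 2 - δ) * meanWidth K : ℝ) : EReal) < (lowerDensity Γ : EReal) := by
  have hne : K.Nonempty := hK.interior_nonempty.mono interior_subset
  have hL : (Real.pi / 2 - δ) * meanWidth K < Real.pi / 2 * meanWidth K :=
    mul_lt_mul_of_pos_right (by linarith) (meanWidth_pos hK)
  obtain ⟨s₀, v₀, hs₀, hLs₀⟩ := exists_inscribed_zonotope hK hL
  obtain ⟨s, v, hs, hLs, hcr⟩ := exists_pairwise_cross_ne_zero _ _ s₀ v₀ hs₀ hLs₀
  set w : s → Plane := fun i => v i with hw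
  rw [← Finset.sum_coe_sort s fun i => ‖v i‖] at hLs
  obtain ⟨ε, hε, hD⟩ := exists_lt_lowerDensity_zeroSet (v := w)
    (fun i j hij => hcr i i.2 j j.2 fun h => hij (Subtype.ext h)) hLs
  obtain ⟨φ, hφ0, hφ⟩ := exists_isRegularSet_zeroSet w hε
  refine ⟨wave w, wave_mem_paleyWiener hK.isCompact.isClosed w
    (signed_sum_mem hK.isCompact hK.convex hne w fun θ => ?_), φ, zeroSet w ε, wave_zero w,
    eLpNorm_wave w, hφ, hφ0, zeroSet_subset, hD⟩
  rw [Finset.sum_coe_sort s fun i => |(inner ℝ (v i) θ : ℝ)|]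
  exact hs θ

theorem pi_div_two_le_of_isSamplingConstant {K : Set Plane} (hK : IsQuarterTurnBody K) {A : ℝ}
    (hA : IsSamplingConstant K A) : Real.pi / 2 ≤ A := by
  by_contra! hlt
  -- With `δ = π/2 - A` the density exceeds `A · W(K)`, and sampling with `p = ∞` would give `1 ≤ C
  -- · 0`.
  obtain ⟨f, hf, φ, Γ, -, hfn, hreg, hφ, hΓ, hD⟩ := exists_wave_vanishing hK (sub_pos.2 hlt)
  obtain ⟨C, hC⟩ := hA φ Γ hreg (by simpa [hφ] using hD) ∞
  have h := hC f hf
  have hzero : eLpNorm f ∞ (hausdorffOne.restrict Γ) = 0 := by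
    have : f =ᵐ[hausdorffOne.restrict Γ] 0 := by
      filter_upwards [ae_restrict_mem hreg.isClosed.measurableSet] with x hx using hΓ hx
    rw [eLpNorm_congr_ae this, eLpNorm_zero]
  rw [hfn, hzero, mul_zero] at h
  exact absurd h (by simp)

theorem isQuarterTurnBody_lpBall {p : ℝ≥0∞} {R : ℝ} (hp : 1 ≤ p) (hR : 0 < R) :
    IsQuarterTurnBody (lpBall p R) := by
  have : Fact (1 ≤ p) := ⟨hp⟩
  -- The identity between the Euclidean and the `ℓ^p` plane is a linear homeomorphism, so convexity,
  -- compactness and interior pull back from a norm ball.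
  set T : Plane ≃L[ℝ] PiLp p (fun _ : Fin 2 => ℝ) :=
    (PiLp.continuousLinearEquiv 2 ℝ (fun _ : Fin 2 => ℝ)).trans
      (PiLp.continuousLinearEquiv p ℝ (fun _ : Fin 2 => ℝ)).symm with hT
  have hball : lpBall p R = T ⁻¹' Metric.closedBall 0 R := by
    ext x
    rw [mem_preimage, mem_closedBall_zero_iff]
    rfl
  refine ⟨?_, ?_, ?_, fun a b => ?_⟩
  · rw [hball]
    exact (convex_closedBall 0 R).linear_preimage T.toLinearEquiv.toLinearMap
  · rw [hball]
    exact T.toHomeomorph.isCompact_preimage.2 (isCompact_closedBall 0 R)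
  · refine ⟨0, mem_interior.2 ⟨T ⁻¹' Metric.ball 0 R, ?_, Metric.isOpen_ball.preimage T.continuous,
      ?_⟩⟩
    · rw [hball]
      exact preimage_mono Metric.ball_subset_closedBall
    · simpa using hR
  · have : ‖(WithLp.toLp p ![a, b] : PiLp p (fun _ : Fin 2 => ℝ))‖ =
        ‖(WithLp.toLp p ![-b, a] : PiLp p (fun _ : Fin 2 => ℝ))‖ := by
      rcases p.trichotomy with rfl | rfl | h
      · simp at hp
      · rw [PiLp.norm_eq_ciSup, PiLp.norm_eq_ciSup]
        refine (Equiv.swap (0 : Fin 2) 1).iSup_congr fun i => ?_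
        fin_cases i <;> simp
      · rw [PiLp.norm_eq_sum h, PiLp.norm_eq_sum h]
        simp [Fin.sum_univ_two, add_comm]
    change ‖(WithLp.toLp p ![a, b] : PiLp p (fun _ : Fin 2 => ℝ))‖ ≤ R ↔
      ‖(WithLp.toLp p ![-b, a] : PiLp p (fun _ : Fin 2 => ℝ))‖ ≤ R
    rw [this]

end MobileSampling

end

theorem theorem3 :
    (∀ K : Set MobileSampling.Plane, MobileSampling.IsQuarterTurnBody K →
      (∀ δ : ℝ, 0 < δ →
        ∃ f ∈ MobileSampling.PaleyWiener ∞ K, ∃ (φ : ℝ → ℝ≥0) (Γ : Set MobileSampling.Plane),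
          f 0 = 1 ∧ eLpNorm f ∞ volume = 1 ∧
          MobileSampling.IsRegularSet φ Γ ∧ φ 0 = 1 ∧ Γ ⊆ {x | f x = 0} ∧
          (((Real.pi / 2 - δ) * MobileSampling.meanWidth K : ℝ) : EReal) <
            (MobileSampling.lowerDensity Γ : EReal)) ∧
      (∀ A : ℝ, MobileSampling.IsSamplingConstant K A → Real.pi / 2 ≤ A)) ∧
    (∀ (p : ℝ≥0∞) (R : ℝ), 1 ≤ p → 0 < R →
      MobileSampling.IsQuarterTurnBody (MobileSampling.lpBall p R)) :=
  ⟨fun _ hK => ⟨fun _ hδ => MobileSampling.exists_wave_vanishing hK hδ,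
      fun _ hA => MobileSampling.pi_div_two_le_of_isSamplingConstant hK hA⟩,
    fun _ _ hp hR => MobileSampling.isQuarterTurnBody_lpBall hp hR⟩
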